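/- Let $A$ be a $C^*$-algebra, let $\otimes$ denote the spatial tensor product of $C^*$-algebras, and let $\Delta : A \to M(A\otimes A)$ be a nondegenerate coassociative $^*$-homomorphism making $A$ a (reduced) locally compact quantum group: $\overline{\mathrm{span}}\,\Delta(A)(A\otimes 1) = A\otimes A = \overline{\mathrm{span}}\,\Delta(A)(1\otimes A)$, and there exist faithful KMS weights $\phi$, $\psi$ on $A$ with $\phi((\mu\otimes \mathrm{id})\Delta(a)) = \mu(1)\phi(a)$ whenever $\mu\in A^*_+$, $a\in A_+$, $\phi(a)<\infty$, and $\psi((\mathrm{id}\otimes\mu)\Delta(a)) = \mu(1)\psi(a)$ whenever $\mu\in A^*_+$, $a\in A_+$, $\psi(a)<\infty$. Assume that $A$ is coamenable, that is, there is a bounded linear functional $\epsilon$ on $A$ with $(\epsilon\otimes \mathrm{id})\Delta = (\mathrm{id}\otimes\epsilon)\Delta = \mathrm{id}$. For $\mu,\nu\in A^*$ put $\mu\star\nu = (\mu\otimes\nu)\Delta$, and let $L_\mu = (\mu\otimes\mathrm{id})\Delta$ and $R_\mu = (\mathrm{id}\otimes\mu)\Delta$, which are bounded linear maps $A\to A$.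 An idempotent state is a state $\omega$ on $A$ with $\omega\star\omega=\omega$; a conditional expectation is a projection of norm one from $A$ onto a $C^*$-subalgebra of $A$. Then for every bounded linear functional $\omega\in A^*$ the following are equivalent: (i) $\omega$ is an idempotent state; (ii) $L_\omega$ is a conditional expectation; (iii) $R_\omega$ is a conditional expectation. -/

import Mathlib

open scoped TensorProduct ENNReal ComplexOrder InnerProductSpace MultiplierAlgebra
open UniformSpace

noncomputable section

/-! ### The spatial tensor product of two C*-algebras -/

section HilbertTensor

variable {H K : Type*} [NormedAddCommGroup H] [InnerProductSpace ℂ H]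
  [NormedAddCommGroup K] [InnerProductSpace ℂ K]

/-- The operator `S ⊗ T` on the Hilbert space tensor product, which is the completion of the
algebraic tensor product of two Hilbert spaces. -/
def opTensor (S : H →L[ℂ] H) (T : K →L[ℂ] K) :
    Completion (H ⊗[ℂ] K) →L[ℂ] Completion (H ⊗[ℂ] K) :=
  (TensorProduct.mapL S T).completion

@[simp]
theorem opTensor_coe (S : H →L[ℂ] H) (T : K →L[ℂ] K) (x : H ⊗[ℂ] K) :
    opTensor S T (x : Completion (H ⊗[ℂ] K)) = (TensorProduct.mapL S T x : H ⊗[ℂ] K) :=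
  ContinuousLinearMap.completion_apply_coe _ _

theorem completion_clm_ext {E F : Type*} [NormedAddCommGroup E] [NormedSpace ℂ E]
    [NormedAddCommGroup F] [NormedSpace ℂ F]
    {S T : Completion E →L[ℂ] F} (h : ∀ x : E, S (x : Completion E) = T x) : S = T := by
  ext x
  induction x using Completion.induction_on with
  | hp => exact isClosed_eq S.continuous T.continuous
  | ih x => exact h x

theorem opTensor_mul (S S' : H →L[ℂ] H) (T T' : K →L[ℂ] K) :
    opTensor (S * S') (T * T') = opTensor S T * opTensor S' T' :=
  completion_clm_ext fun x => by
    simp [TensorProduct.mapL_mul, -TensorProduct.mapL_apply]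

theorem opTensor_add_left (S S' : H →L[ℂ] H) (T : K →L[ℂ] K) :
    opTensor (S + S') T = opTensor S T + opTensor S' T :=
  completion_clm_ext fun x => by
    simp [TensorProduct.mapL_add_left, -TensorProduct.mapL_apply, Completion.coe_add]

theorem opTensor_add_right (S : H →L[ℂ] H) (T T' : K →L[ℂ] K) :
    opTensor S (T + T') = opTensor S T + opTensor S T' :=
  completion_clm_ext fun x => by
    simp [TensorProduct.mapL_add_right, -TensorProduct.mapL_apply, Completion.coe_add]

theorem opTensor_smul_left (c : ℂ) (S : H →L[ℂ] H) (T : K →L[ℂ] K) :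
    opTensor (c • S) T = c • opTensor S T :=
  completion_clm_ext fun x => by
    simp [TensorProduct.mapL_smul_left, -TensorProduct.mapL_apply, Completion.coe_smul]

theorem opTensor_smul_right (c : ℂ) (S : H →L[ℂ] H) (T : K →L[ℂ] K) :
    opTensor S (c • T) = c • opTensor S T :=
  completion_clm_ext fun x => by
    simp [TensorProduct.mapL_smul_right, -TensorProduct.mapL_apply, Completion.coe_smul]

theorem opTensor_star [CompleteSpace H] [CompleteSpace K] (S : H →L[ℂ] H) (T : K →L[ℂ] K) :
    opTensor (star S) (star T) = star (opTensor S T) := by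
  refine (ContinuousLinearMap.eq_adjoint_iff _ _).mpr fun x y => ?_
  induction x, y using Completion.induction_on₂ with
  | hp => apply isClosed_eq <;> fun_prop
  | ih x y =>
    rw [opTensor_coe, opTensor_coe, Completion.inner_coe, Completion.inner_coe]
    induction x using TensorProduct.induction_on with
    | zero => simp
    | add x₁ x₂ h₁ h₂ => rw [map_add, inner_add_left, inner_add_left, h₁, h₂]
    | tmul h k =>
      induction y using TensorProduct.induction_on with
      | zero => simp
      | add y₁ y₂ h₁ h₂ => rw [map_add, inner_add_right, inner_add_right, h₁, h₂]
      | tmul h' k' =>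
        simp [ContinuousLinearMap.star_eq_adjoint, ContinuousLinearMap.adjoint_inner_left]

theorem norm_opTensor_le (S : H →L[ℂ] H) (T : K →L[ℂ] K) : ‖opTensor S T‖ ≤ ‖S‖ * ‖T‖ := by
  refine ContinuousLinearMap.opNorm_le_bound _ (by positivity) fun x => ?_
  induction x using Completion.induction_on with
  | hp => apply isClosed_le <;> fun_prop
  | ih x =>
    rw [opTensor_coe, Completion.norm_coe, Completion.norm_coe]
    exact (TensorProduct.mapL S T).le_of_opNorm_le (TensorProduct.norm_mapL_le S T) x

end HilbertTensor

section MinTensor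

variable (A B : Type*)
  [NonUnitalCStarAlgebra A] [PartialOrder A] [StarOrderedRing A]
  [NonUnitalCStarAlgebra B] [PartialOrder B] [StarOrderedRing B]

variable {A B} in
/-- The bounded operators on `H_f ⊗ K_g`, where `H_f` and `K_g` are the GNS spaces of the positive
functionals `f` of `A` and `g` of `B`. -/
def BlockOp (p : (A →ₚ[ℂ] ℂ) × (B →ₚ[ℂ] ℂ)) : Type _ :=
  Completion (p.1.GNS ⊗[ℂ] p.2.GNS) →L[ℂ] Completion (p.1.GNS ⊗[ℂ] p.2.GNS)

instance (p : (A →ₚ[ℂ] ℂ) × (B →ₚ[ℂ] ℂ)) : CStarAlgebra (BlockOp p) :=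
  inferInstanceAs (CStarAlgebra
    (Completion (p.1.GNS ⊗[ℂ] p.2.GNS) →L[ℂ] Completion (p.1.GNS ⊗[ℂ] p.2.GNS)))

/-- The block diagonal operators on the Hilbert space `⨁ (H_f ⊗ K_g)`, where `f` and `g` run
through all positive functionals of `A` and of `B`; this Hilbert space is the tensor product of the
spaces `⨁ H_f` and `⨁ K_g` of the universal representations of `A` and of `B`. -/
def UniversalBlocks : Type _ :=
  lp (fun p : (A →ₚ[ℂ] ℂ) × (B →ₚ[ℂ] ℂ) => BlockOp p) ∞

instance : NonUnitalCStarAlgebra (UniversalBlocks A B) :=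
  inferInstanceAs (NonUnitalCStarAlgebra (lp (fun p : (A →ₚ[ℂ] ℂ) × (B →ₚ[ℂ] ℂ) => BlockOp p) ∞))

variable {A B}

/-- The block at `p` of a block diagonal operator. -/
def UniversalBlocks.block (p : (A →ₚ[ℂ] ℂ) × (B →ₚ[ℂ] ℂ)) : UniversalBlocks A B →⋆ₙₐ[ℂ] BlockOp p where
  toFun x := x.1 p
  map_smul' _ _ := rfl
  map_zero' := rfl
  map_add' _ _ := rfl
  map_mul' _ _ := rfl
  map_star' _ := rfl

theorem UniversalBlocks.ext {x y : UniversalBlocks A B} (h : ∀ p, block p x = block p y) : x = y :=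
  lp.ext (funext h)

/-- The operator `S ⊗ T` on `H_f ⊗ K_g`, for operators `S` on `H_f` and `T` on `K_g`. -/
def blockTensor (p : (A →ₚ[ℂ] ℂ) × (B →ₚ[ℂ] ℂ)) (S : p.1.GNS →L[ℂ] p.1.GNS)
    (T : p.2.GNS →L[ℂ] p.2.GNS) : BlockOp p :=
  opTensor S T

theorem blockTensor_mul (p : (A →ₚ[ℂ] ℂ) × (B →ₚ[ℂ] ℂ)) (S S' : p.1.GNS →L[ℂ] p.1.GNS)
    (T T' : p.2.GNS →L[ℂ] p.2.GNS) :
    blockTensor p S T * blockTensor p S' T' = blockTensor p (S * S') (T * T') :=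
  (opTensor_mul S S' T T').symm

theorem blockTensor_star (p : (A →ₚ[ℂ] ℂ) × (B →ₚ[ℂ] ℂ)) (S : p.1.GNS →L[ℂ] p.1.GNS)
    (T : p.2.GNS →L[ℂ] p.2.GNS) :
    star (blockTensor p S T) = blockTensor p (star S) (star T) :=
  (opTensor_star S T).symm

/-- The operator `π(a) ⊗ 1`, where `π` is the universal representation of `A`. -/
def ampLeft (a : A) : UniversalBlocks A B :=
  ⟨fun p => blockTensor p (p.1.gnsNonUnitalStarAlgHom a) 1, memℓp_infty ⟨‖a‖, by
    rintro _ ⟨p, rfl⟩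
    refine (norm_opTensor_le _ _).trans ?_
    calc _ ≤ ‖a‖ * 1 := mul_le_mul (NonUnitalStarAlgHom.norm_apply_le _ a)
            ContinuousLinearMap.norm_id_le (norm_nonneg _) (norm_nonneg _)
      _ = ‖a‖ := mul_one _⟩⟩

/-- The operator `1 ⊗ ρ(b)`, where `ρ` is the universal representation of `B`. -/
def ampRight (b : B) : UniversalBlocks A B :=
  ⟨fun p => blockTensor p 1 (p.2.gnsNonUnitalStarAlgHom b), memℓp_infty ⟨‖b‖, by
    rintro _ ⟨p, rfl⟩
    refine (norm_opTensor_le _ _).trans ?_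
    calc _ ≤ 1 * ‖b‖ := mul_le_mul ContinuousLinearMap.norm_id_le
            (NonUnitalStarAlgHom.norm_apply_le _ b) (norm_nonneg _) zero_le_one
      _ = ‖b‖ := one_mul _⟩⟩

/-- The operator `π(a) ⊗ ρ(b)`. -/
def blockTmul (a : A) (b : B) : UniversalBlocks A B :=
  (ampLeft a : UniversalBlocks A B) * (ampRight b : UniversalBlocks A B)

theorem block_ampLeft (a : A) (p : (A →ₚ[ℂ] ℂ) × (B →ₚ[ℂ] ℂ)) :
    UniversalBlocks.block p (ampLeft a) = blockTensor p (p.1.gnsNonUnitalStarAlgHom a) 1 := rfl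

theorem block_ampRight (b : B) (p : (A →ₚ[ℂ] ℂ) × (B →ₚ[ℂ] ℂ)) :
    UniversalBlocks.block p (ampRight b) = blockTensor p 1 (p.2.gnsNonUnitalStarAlgHom b) := rfl

theorem block_blockTmul (a : A) (b : B) (p : (A →ₚ[ℂ] ℂ) × (B →ₚ[ℂ] ℂ)) :
    UniversalBlocks.block p (blockTmul a b) =
      blockTensor p (p.1.gnsNonUnitalStarAlgHom a) (p.2.gnsNonUnitalStarAlgHom b) := by
  rw [blockTmul, map_mul, block_ampLeft, block_ampRight, blockTensor_mul, mul_one, one_mul]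

theorem ampLeft_mul_blockTmul (c a : A) (b : B) :
    (ampLeft c : UniversalBlocks A B) * blockTmul a b = blockTmul (c * a) b :=
  UniversalBlocks.ext fun p => by
    rw [map_mul, block_ampLeft, block_blockTmul, block_blockTmul, blockTensor_mul, one_mul,
      map_mul]

theorem blockTmul_mul_ampLeft (a c : A) (b : B) :
    blockTmul a b * (ampLeft c : UniversalBlocks A B) = blockTmul (a * c) b :=
  UniversalBlocks.ext fun p => by
    rw [map_mul, block_ampLeft, block_blockTmul, block_blockTmul, blockTensor_mul, mul_one,
      map_mul]

theorem ampRight_mul_blockTmul (a : A) (c b : B) :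
    (ampRight c : UniversalBlocks A B) * blockTmul a b = blockTmul a (c * b) :=
  UniversalBlocks.ext fun p => by
    rw [map_mul, block_ampRight, block_blockTmul, block_blockTmul, blockTensor_mul, one_mul,
      map_mul]

theorem blockTmul_mul_ampRight (a : A) (b c : B) :
    blockTmul a b * (ampRight c : UniversalBlocks A B) = blockTmul a (b * c) :=
  UniversalBlocks.ext fun p => by
    rw [map_mul, block_ampRight, block_blockTmul, block_blockTmul, blockTensor_mul, mul_one,
      map_mul]

theorem blockTmul_mul (a a' : A) (b b' : B) :
    (blockTmul a b : UniversalBlocks A B) * blockTmul a' b' = blockTmul (a * a') (b * b') :=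
  UniversalBlocks.ext fun p => by
    rw [map_mul, block_blockTmul, block_blockTmul, block_blockTmul, blockTensor_mul, map_mul,
      map_mul]

theorem blockTmul_star (a : A) (b : B) :
    star (blockTmul a b : UniversalBlocks A B) = blockTmul (star a) (star b) :=
  UniversalBlocks.ext fun p => by
    rw [map_star, block_blockTmul, block_blockTmul, blockTensor_star, map_star, map_star]

variable (A B)

/-- The algebraic tensor product of `A` and `B`, represented as operators. -/
def algTensor : NonUnitalStarSubalgebra ℂ (UniversalBlocks A B) where
  __ := Submodule.span ℂ (Set.range fun p : A × B => blockTmul p.1 p.2)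
  mul_mem' := by
    intro x y hx hy
    refine Submodule.span_induction₂ (p := fun x y _ _ =>
      x * y ∈ Submodule.span ℂ (Set.range fun p : A × B => blockTmul p.1 p.2))
      ?_ ?_ ?_ ?_ ?_ ?_ ?_ hx hy
    · rintro _ _ ⟨p, rfl⟩ ⟨q, rfl⟩
      exact Submodule.subset_span ⟨(p.1 * q.1, p.2 * q.2), (blockTmul_mul _ _ _ _).symm⟩
    · intro y _
      simp
    · intro x _
      simp
    · intro x y z _ _ _ h h'
      simpa [add_mul] using Submodule.add_mem _ h h'
    · intro x y z _ _ _ h h'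
      simpa [mul_add] using Submodule.add_mem _ h h'
    · intro r x y _ _ h
      simpa only [smul_mul_assoc] using Submodule.smul_mem _ r h
    · intro r x y _ _ h
      simpa only [mul_smul_comm] using Submodule.smul_mem _ r h
  star_mem' := by
    intro x hx
    refine Submodule.span_induction (p := fun x _ =>
      star x ∈ Submodule.span ℂ (Set.range fun p : A × B => blockTmul p.1 p.2)) ?_ ?_ ?_ ?_ hx
    · rintro _ ⟨p, rfl⟩
      exact Submodule.subset_span ⟨(star p.1, star p.2), (blockTmul_star _ _).symm⟩
    · simp
    · intro x y _ _ h h'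
      simpa using Submodule.add_mem _ h h'
    · intro r x _ h
      simpa using Submodule.smul_mem _ (star r) h

/-- The spatial (minimal) tensor product of two C*-algebras: the norm closure of the linear span
of the operators `π(a) ⊗ ρ(b)`, for the universal representations `π` of `A` and `ρ` of `B`. -/
def MinTensor : Type _ := (algTensor A B).topologicalClosure

instance : NonUnitalCStarAlgebra (MinTensor A B) :=
  NonUnitalStarSubalgebra.nonUnitalCStarAlgebra (algTensor A B).topologicalClosure
    (h_closed := NonUnitalStarSubalgebra.isClosed_topologicalClosure _)

instance : PartialOrder (MinTensor A B) := CStarAlgebra.spectralOrder _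

instance : StarOrderedRing (MinTensor A B) := CStarAlgebra.spectralOrderedRing _

end MinTensor

infixl:75 " ⊗ₛ " => MinTensor

namespace MinTensor

variable {A B : Type*}
  [NonUnitalCStarAlgebra A] [PartialOrder A] [StarOrderedRing A]
  [NonUnitalCStarAlgebra B] [PartialOrder B] [StarOrderedRing B]

/-- The inclusion of the spatial tensor product into the operators. -/
def val : A ⊗ₛ B →⋆ₙₐ[ℂ] UniversalBlocks A B :=
  NonUnitalStarSubalgebraClass.subtype (algTensor A B).topologicalClosure

theorem val_injective : Function.Injective (val : A ⊗ₛ B → UniversalBlocks A B) :=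
  Subtype.val_injective

/-- The elementary tensor `a ⊗ b`. -/
def tmul (a : A) (b : B) : A ⊗ₛ B :=
  ⟨blockTmul a b, subset_closure (Submodule.subset_span ⟨(a, b), rfl⟩)⟩

theorem val_tmul (a : A) (b : B) : val (tmul a b) = blockTmul a b := rfl

theorem val_ext {x y : A ⊗ₛ B}
    (h : ∀ p, UniversalBlocks.block p (val x) = UniversalBlocks.block p (val y)) : x = y :=
  val_injective (UniversalBlocks.ext h)

/-- The embedding of the algebraic tensor product of `A` and `B`, with values
`a ⊗ₜ b ↦ tmul a b`. -/
def ofTensor : A ⊗[ℂ] B →ₗ[ℂ] A ⊗ₛ B :=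
  TensorProduct.lift <| LinearMap.mk₂ ℂ tmul
    (fun a a' b => val_ext fun p => by
      simp only [map_add, val_tmul, block_blockTmul]
      exact opTensor_add_left _ _ _)
    (fun c a b => val_ext fun p => by
      simp only [map_smul, val_tmul, block_blockTmul]
      exact opTensor_smul_left _ _ _)
    (fun a b b' => val_ext fun p => by
      simp only [map_add, val_tmul, block_blockTmul]
      exact opTensor_add_right _ _ _)
    (fun c a b => val_ext fun p => by
      simp only [map_smul, val_tmul, block_blockTmul]
      exact opTensor_smul_right _ _ _)

@[simp]
theorem ofTensor_tmul (a : A) (b : B) : ofTensor (a ⊗ₜ[ℂ] b) = tmul a b := rfl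

theorem tmul_mul_tmul (a a' : A) (b b' : B) :
    tmul a b * tmul a' b' = tmul (a * a') (b * b') :=
  val_injective (blockTmul_mul a a' b b')

theorem star_tmul (a : A) (b : B) : star (tmul a b) = tmul (star a) (star b) :=
  val_injective (blockTmul_star a b)

theorem mul_mem_of_forall {m : UniversalBlocks A B}
    (h : ∀ a b, m * blockTmul a b ∈ algTensor A B) {x : UniversalBlocks A B}
    (hx : x ∈ (algTensor A B).topologicalClosure) :
    m * x ∈ (algTensor A B).topologicalClosure := by
  refine map_mem_closure (f := fun y => m * y) (by fun_prop) hx fun y hy => ?_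
  refine Submodule.span_induction (p := fun y _ => m * y ∈ algTensor A B) ?_ ?_ ?_ ?_ hy
  · rintro _ ⟨p, rfl⟩
    exact h _ _
  · simp
  · intro y z _ _ hy hz
    rw [mul_add]
    exact add_mem hy hz
  · intro c y _ hy
    simpa only [mul_smul_comm] using SMulMemClass.smul_mem c hy

theorem mem_mul_of_forall {m : UniversalBlocks A B}
    (h : ∀ a b, blockTmul a b * m ∈ algTensor A B) {x : UniversalBlocks A B}
    (hx : x ∈ (algTensor A B).topologicalClosure) :
    x * m ∈ (algTensor A B).topologicalClosure := by
  refine map_mem_closure (f := fun y => y * m) (by fun_prop) hx fun y hy => ?_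
  refine Submodule.span_induction (p := fun y _ => y * m ∈ algTensor A B) ?_ ?_ ?_ ?_ hy
  · rintro _ ⟨p, rfl⟩
    exact h _ _
  · simp
  · intro y z _ _ hy hz
    rw [add_mul]
    exact add_mem hy hz
  · intro c y _ hy
    simpa only [smul_mul_assoc] using SMulMemClass.smul_mem c hy

/-- The multiplier of `A ⊗ₛ B` given by multiplication with an operator `m`. -/
def multiplier (m : UniversalBlocks A B) (hl : ∀ a b, m * blockTmul a b ∈ algTensor A B)
    (hr : ∀ a b, blockTmul a b * m ∈ algTensor A B) : 𝓜(ℂ, A ⊗ₛ B) where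
  fst := LinearMap.mkContinuous
    { toFun := fun x => (⟨m * val x, mul_mem_of_forall hl x.2⟩ : (algTensor A B).topologicalClosure)
      map_add' := fun x y => val_injective (by
        change m * val (x + y) = m * val x + m * val y
        rw [map_add, mul_add])
      map_smul' := fun c x => val_injective (by
        change m * val (c • x) = c • (m * val x)
        rw [map_smul, mul_smul_comm]) } ‖m‖ (fun x => norm_mul_le m (val x))
  snd := LinearMap.mkContinuous
    { toFun := fun x => (⟨val x * m, mem_mul_of_forall hr x.2⟩ : (algTensor A B).topologicalClosure)
      map_add' := fun x y => val_injective (by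
        change val (x + y) * m = val x * m + val y * m
        rw [map_add, add_mul])
      map_smul' := fun c x => val_injective (by
        change val (c • x) * m = c • (val x * m)
        rw [map_smul, smul_mul_assoc]) } ‖m‖
          (fun x => (norm_mul_le (val x) m).trans_eq (mul_comm _ _))
  central := fun x y => val_injective (mul_assoc (val x) m (val y))

/-- The multiplier `a ⊗ 1` of `A ⊗ₛ B`. -/
def inl (a : A) : 𝓜(ℂ, A ⊗ₛ B) :=
  multiplier (ampLeft a)
    (fun c b => by
      rw [ampLeft_mul_blockTmul]
      exact Submodule.subset_span ⟨(a * c, b), rfl⟩)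
    (fun c b => by
      rw [blockTmul_mul_ampLeft]
      exact Submodule.subset_span ⟨(c * a, b), rfl⟩)

/-- The multiplier `1 ⊗ b` of `A ⊗ₛ B`. -/
def inr (b : B) : 𝓜(ℂ, A ⊗ₛ B) :=
  multiplier (ampRight b)
    (fun a c => by
      rw [ampRight_mul_blockTmul]
      exact Submodule.subset_span ⟨(a, b * c), rfl⟩)
    (fun a c => by
      rw [blockTmul_mul_ampRight]
      exact Submodule.subset_span ⟨(a, c * b), rfl⟩)

theorem inl_fst_tmul (c a : A) (b : B) :
    (inl c : 𝓜(ℂ, A ⊗ₛ B)).fst (tmul a b) = tmul (c * a) b :=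
  val_injective (ampLeft_mul_blockTmul c a b)

theorem inr_fst_tmul (a : A) (c b : B) :
    (inr c : 𝓜(ℂ, A ⊗ₛ B)).fst (tmul a b) = tmul a (c * b) :=
  val_injective (ampRight_mul_blockTmul a c b)

/-- The slice map `ω ⊗ id`: the bounded linear map with `a ⊗ b ↦ ω(a) b`. -/
def sliceLeft (ω : A →L[ℂ] ℂ) : A ⊗ₛ B →L[ℂ] B :=
  LinearMap.extendOfNorm
    ((TensorProduct.lid ℂ B).toLinearMap ∘ₗ TensorProduct.map ω.toLinearMap LinearMap.id) ofTensor

/-- The slice map `id ⊗ ω`: the bounded linear map with `a ⊗ b ↦ ω(b) a`. -/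
def sliceRight (ω : B →L[ℂ] ℂ) : A ⊗ₛ B →L[ℂ] A :=
  LinearMap.extendOfNorm
    ((TensorProduct.rid ℂ A).toLinearMap ∘ₗ TensorProduct.map LinearMap.id ω.toLinearMap) ofTensor

end MinTensor

/-! ### Coproducts -/

section Coproduct

variable {A B C D : Type*}
  [NonUnitalCStarAlgebra A] [PartialOrder A] [StarOrderedRing A]
  [NonUnitalCStarAlgebra B] [PartialOrder B] [StarOrderedRing B]
  [NonUnitalCStarAlgebra C] [PartialOrder C] [StarOrderedRing C]
  [NonUnitalCStarAlgebra D] [PartialOrder D] [StarOrderedRing D]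

/-- A *-homomorphism `π : A → M(B)` is nondegenerate if the linear span of `π(A)B` is dense
in `B`. -/
def IsNondegenerate (π : A →⋆ₙₐ[ℂ] 𝓜(ℂ, B)) : Prop :=
  (Submodule.span ℂ {x : B | ∃ a b, x = (π a).fst b}).topologicalClosure = ⊤

/-- `Φ : M(A ⊗ B) → M(C ⊗ D)` is the (strict extension to multipliers of the) tensor product
`π ⊗ ρ` of the *-homomorphisms `π : A → M(C)` and `ρ : B → M(D)`. When `π` and `ρ` are
nondegenerate, there is exactly one such `Φ`. -/
def IsTensorHom (π : A →⋆ₙₐ[ℂ] 𝓜(ℂ, C)) (ρ : B →⋆ₙₐ[ℂ] 𝓜(ℂ, D))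
    (Φ : 𝓜(ℂ, A ⊗ₛ B) →⋆ₐ[ℂ] 𝓜(ℂ, C ⊗ₛ D)) : Prop :=
  ∀ (a : A) (b : B) (c : C) (d : D),
    (Φ (MinTensor.tmul a b : A ⊗ₛ B)).fst (MinTensor.tmul c d) =
      MinTensor.tmul ((π a).fst c) ((ρ b).fst d)

/-- `α` is the canonical identification of `(A ⊗ B) ⊗ C` with `A ⊗ (B ⊗ C)`; there is exactly
one. -/
def IsAssociator (α : A ⊗ₛ B ⊗ₛ C ≃⋆ₐ[ℂ] A ⊗ₛ (B ⊗ₛ C)) : Prop :=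
  ∀ (a : A) (b : B) (c : C), α (MinTensor.tmul (MinTensor.tmul a b) c) =
    MinTensor.tmul a (MinTensor.tmul b c)

/-- Coassociativity `(Δ ⊗ id)Δ = (id ⊗ Δ)Δ`, where `Δ ⊗ id` and `id ⊗ Δ` are extended to multipliers
and the two triple tensor products are identified canonically. -/
def IsCoassociative (Δ : A →⋆ₙₐ[ℂ] 𝓜(ℂ, A ⊗ₛ A)) : Prop :=
  ∃ (α : A ⊗ₛ A ⊗ₛ A ≃⋆ₐ[ℂ] A ⊗ₛ (A ⊗ₛ A))
    (Φ : 𝓜(ℂ, A ⊗ₛ A) →⋆ₐ[ℂ] 𝓜(ℂ, A ⊗ₛ A ⊗ₛ A))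
    (Ψ : 𝓜(ℂ, A ⊗ₛ A) →⋆ₐ[ℂ] 𝓜(ℂ, A ⊗ₛ (A ⊗ₛ A))),
    IsAssociator α ∧ IsTensorHom Δ DoubleCentralizer.coeHom Φ ∧
      IsTensorHom DoubleCentralizer.coeHom Δ Ψ ∧
      ∀ (a : A) (x : A ⊗ₛ A ⊗ₛ A), α ((Φ (Δ a)).fst x) = (Ψ (Δ a)).fst (α x)

/-- `L = (ω ⊗ id)Δ` as a map `A → A`: the element `(ω ⊗ id)(Δ(a))` is determined by
`(ω ⊗ id)(Δ(a)) d = (ω ⊗ id)(Δ(a)(1 ⊗ d))`, where `Δ(a)(1 ⊗ d)` belongs to `A ⊗ A`. -/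
def IsLeftConvolution (Δ : A →⋆ₙₐ[ℂ] 𝓜(ℂ, A ⊗ₛ A)) (ω : A →L[ℂ] ℂ) (L : A →L[ℂ] A) : Prop :=
  ∀ a d : A, ∃ t : A ⊗ₛ A, (t : 𝓜(ℂ, A ⊗ₛ A)) = Δ a * MinTensor.inr d ∧
    L a * d = MinTensor.sliceLeft ω t

/-- `R = (id ⊗ ω)Δ` as a map `A → A`: the element `(id ⊗ ω)(Δ(a))` is determined by
`(id ⊗ ω)(Δ(a)) d = (id ⊗ ω)(Δ(a)(d ⊗ 1))`, where `Δ(a)(d ⊗ 1)` belongs to `A ⊗ A`. -/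
def IsRightConvolution (Δ : A →⋆ₙₐ[ℂ] 𝓜(ℂ, A ⊗ₛ A)) (ω : A →L[ℂ] ℂ) (R : A →L[ℂ] A) : Prop :=
  ∀ a d : A, ∃ t : A ⊗ₛ A, (t : 𝓜(ℂ, A ⊗ₛ A)) = Δ a * MinTensor.inl d ∧
    R a * d = MinTensor.sliceRight ω t

open Classical in
/-- The convolution operator `L_ω = (ω ⊗ id)Δ`. -/
def leftConvolution (Δ : A →⋆ₙₐ[ℂ] 𝓜(ℂ, A ⊗ₛ A)) (ω : A →L[ℂ] ℂ) : A →L[ℂ] A :=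
  if h : ∃ L, IsLeftConvolution Δ ω L then h.choose else 0

open Classical in
/-- The convolution operator `R_ω = (id ⊗ ω)Δ`. -/
def rightConvolution (Δ : A →⋆ₙₐ[ℂ] 𝓜(ℂ, A ⊗ₛ A)) (ω : A →L[ℂ] ℂ) : A →L[ℂ] A :=
  if h : ∃ R, IsRightConvolution Δ ω R then h.choose else 0

theorem coe_multiplier_injective {E : Type*} [NonUnitalCStarAlgebra E] {t t' : E}
    (h : (t : 𝓜(ℂ, E)) = (t' : 𝓜(ℂ, E))) : t = t' := by
  have key : ∀ x : E, t * x = t' * x := fun x => congrArg (fun m : 𝓜(ℂ, E) => m.fst x) h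
  have := key (star (t - t'))
  rwa [← sub_eq_zero, ← sub_mul, CStarRing.mul_star_self_eq_zero_iff, sub_eq_zero] at this

theorem IsLeftConvolution.unique {Δ : A →⋆ₙₐ[ℂ] 𝓜(ℂ, A ⊗ₛ A)} {ω : A →L[ℂ] ℂ} {L L' : A →L[ℂ] A}
    (h : IsLeftConvolution Δ ω L) (h' : IsLeftConvolution Δ ω L') : L = L' := by
  ext a
  have key : ∀ d, L a * d = L' a * d := fun d => by
    obtain ⟨t, ht, h1⟩ := h a d
    obtain ⟨t', ht', h2⟩ := h' a d
    rw [h1, h2, coe_multiplier_injective (ht.trans ht'.symm)]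
  have := key (star (L a - L' a))
  rwa [← sub_eq_zero, ← sub_mul, CStarRing.mul_star_self_eq_zero_iff, sub_eq_zero] at this

theorem IsRightConvolution.unique {Δ : A →⋆ₙₐ[ℂ] 𝓜(ℂ, A ⊗ₛ A)} {ω : A →L[ℂ] ℂ} {R R' : A →L[ℂ] A}
    (h : IsRightConvolution Δ ω R) (h' : IsRightConvolution Δ ω R') : R = R' := by
  ext a
  have key : ∀ d, R a * d = R' a * d := fun d => by
    obtain ⟨t, ht, h1⟩ := h a d
    obtain ⟨t', ht', h2⟩ := h' a d
    rw [h1, h2, coe_multiplier_injective (ht.trans ht'.symm)]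
  have := key (star (R a - R' a))
  rwa [← sub_eq_zero, ← sub_mul, CStarRing.mul_star_self_eq_zero_iff, sub_eq_zero] at this

/-- The convolution `μ ⋆ ν = (μ ⊗ ν)Δ` of functionals, as `ν ∘ (μ ⊗ id)Δ`. -/
def convolution (Δ : A →⋆ₙₐ[ℂ] 𝓜(ℂ, A ⊗ₛ A)) (μ ν : A →L[ℂ] ℂ) : A →L[ℂ] ℂ :=
  ν ∘L leftConvolution Δ μ

end Coproduct

/-! ### Weights -/

section Weights

/-- A weight on a C*-algebra: an additive and positively homogeneous map from the positive cone to
`[0, ∞]` (the values at elements that are not positive are irrelevant). -/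
structure CStarWeight (A : Type*) [NonUnitalCStarAlgebra A] [PartialOrder A] where
  toFun : A → ℝ≥0∞
  map_add : ∀ a b, 0 ≤ a → 0 ≤ b → toFun (a + b) = toFun a + toFun b
  map_smul : ∀ (r : ℝ) (a : A), 0 ≤ r → 0 ≤ a → toFun (r • a) = ENNReal.ofReal r * toFun a

variable {A : Type*} [NonUnitalCStarAlgebra A] [PartialOrder A] [StarOrderedRing A]

namespace CStarWeight

instance : CoeFun (CStarWeight A) fun _ => A → ℝ≥0∞ := ⟨toFun⟩

def IsDenselyDefined (φ : CStarWeight A) : Prop :=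
  {a : A | 0 ≤ a} ⊆ closure {a : A | 0 ≤ a ∧ φ a < ∞}

def IsLowerSemicontinuous (φ : CStarWeight A) : Prop :=
  LowerSemicontinuousOn φ {a : A | 0 ≤ a}

def IsFaithful (φ : CStarWeight A) : Prop :=
  ∀ a : A, 0 ≤ a → φ a = 0 → a = 0

end CStarWeight

/-- A norm continuous one-parameter group of *-automorphisms. -/
structure OneParameterGroup (A : Type*) [NonUnitalCStarAlgebra A] where
  toAut : ℝ → (A ≃⋆ₐ[ℂ] A)
  map_zero : ∀ a, toAut 0 a = a
  map_add : ∀ s t a, toAut (s + t) a = toAut s (toAut t a)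
  continuous : ∀ a, Continuous fun t => toAut t a

/-- `b = σ_{i/2}(a)`, where `σ_{i/2}` is the analytic extension of `σ` to the point `i/2`: there is
a continuous function on the strip `0 ≤ Im z ≤ 1/2`, analytic in the interior, with values `σ_t(a)`
at real `t` and `b` at `i/2`. -/
def OneParameterGroup.IsHalfExtension (σ : OneParameterGroup A) (a b : A) : Prop :=
  ∃ F : ℂ → A, DiffContOnCl ℂ F {z : ℂ | 0 < z.im ∧ z.im < 1 / 2} ∧
    (∀ t : ℝ, F t = σ.toAut t a) ∧ F (Complex.I / 2) = b

/-- A KMS weight: a densely defined lower semicontinuous weight `φ` for which there is a norm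
continuous one-parameter group `σ` with `φ ∘ σ_t = φ` and
`φ(a* a) = φ(σ_{i/2}(a) σ_{i/2}(a)*)` for all `a` in the domain of `σ_{i/2}`. -/
def CStarWeight.IsKMS (φ : CStarWeight A) : Prop :=
  φ.IsDenselyDefined ∧ φ.IsLowerSemicontinuous ∧ ∃ σ : OneParameterGroup A,
    (∀ (t : ℝ) (a : A), 0 ≤ a → φ (σ.toAut t a) = φ a) ∧
    ∀ a b : A, σ.IsHalfExtension a b → φ (star a * a) = φ (b * star b)

end Weights

/-! ### Locally compact quantum groups -/

/-- A bounded functional is positive. -/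
def IsPositiveFunctional {A : Type*} [NonUnitalCStarAlgebra A] [PartialOrder A]
    (ω : A →L[ℂ] ℂ) : Prop :=
  ∀ a : A, 0 ≤ a → 0 ≤ ω a

/-- A state: a positive functional of norm one. -/
def IsState {A : Type*} [NonUnitalCStarAlgebra A] [PartialOrder A] (ω : A →L[ℂ] ℂ) : Prop :=
  IsPositiveFunctional ω ∧ ‖ω‖ = 1

/-- A locally compact quantum group: a C*-algebra `A` with a coproduct `Δ` that satisfies the
quantum cancellation laws and has a left and a right invariant faithful KMS weight. In the
invariance conditions, `‖ω‖ = ω(1)` as `ω` is positive. -/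
structure LocallyCompactQuantumGroup (A : Type*)
    [NonUnitalCStarAlgebra A] [PartialOrder A] [StarOrderedRing A] where
  comul : A →⋆ₙₐ[ℂ] 𝓜(ℂ, A ⊗ₛ A)
  nondegenerate : IsNondegenerate comul
  coassociative : IsCoassociative comul
  cancellation_left :
    ((Submodule.span ℂ {m : 𝓜(ℂ, A ⊗ₛ A) | ∃ a b, m = comul a * MinTensor.inl b}).topologicalClosure
      : Set 𝓜(ℂ, A ⊗ₛ A)) = Set.range (DoubleCentralizer.coe ℂ)
  cancellation_right :
    ((Submodule.span ℂ {m : 𝓜(ℂ, A ⊗ₛ A) | ∃ a b, m = comul a * MinTensor.inr b}).topologicalClosure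
      : Set 𝓜(ℂ, A ⊗ₛ A)) = Set.range (DoubleCentralizer.coe ℂ)
  exists_leftHaar : ∃ φ : CStarWeight A, φ.IsKMS ∧ φ.IsFaithful ∧
    ∀ ω : A →L[ℂ] ℂ, IsPositiveFunctional ω → ∀ a, 0 ≤ a → φ a < ∞ →
      φ (leftConvolution comul ω a) = ENNReal.ofReal ‖ω‖ * φ a
  exists_rightHaar : ∃ ψ : CStarWeight A, ψ.IsKMS ∧ ψ.IsFaithful ∧
    ∀ ω : A →L[ℂ] ℂ, IsPositiveFunctional ω → ∀ a, 0 ≤ a → ψ a < ∞ →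
      ψ (rightConvolution comul ω a) = ENNReal.ofReal ‖ω‖ * ψ a

namespace LocallyCompactQuantumGroup

variable {A : Type*} [NonUnitalCStarAlgebra A] [PartialOrder A] [StarOrderedRing A]

/-- The convolution operator `L_ω = (ω ⊗ id)Δ`. -/
def L (G : LocallyCompactQuantumGroup A) (ω : A →L[ℂ] ℂ) : A →L[ℂ] A :=
  leftConvolution G.comul ω

/-- The convolution operator `R_ω = (id ⊗ ω)Δ`. -/
def R (G : LocallyCompactQuantumGroup A) (ω : A →L[ℂ] ℂ) : A →L[ℂ] A :=
  rightConvolution G.comul ω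

/-- A quantum group is coamenable if it has a bounded counit, that is, a bounded functional `ε` with
`(ε ⊗ id)Δ = id = (id ⊗ ε)Δ`. -/
def IsCoamenable (G : LocallyCompactQuantumGroup A) : Prop :=
  ∃ ε : A →L[ℂ] ℂ, (∀ a, G.L ε a = a) ∧ ∀ a, G.R ε a = a

/-- An idempotent state: a state `ω` with `ω ⋆ ω = ω`. -/
def IsIdempotentState (G : LocallyCompactQuantumGroup A) (ω : A →L[ℂ] ℂ) : Prop :=
  IsState ω ∧ convolution G.comul ω ω = ω

end LocallyCompactQuantumGroup

/-- A conditional expectation on a C*-algebra: a projection of norm one onto a C*-subalgebra. -/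
def IsConditionalExpectation {A : Type*} [NonUnitalCStarAlgebra A] (E : A →L[ℂ] A) : Prop :=
  ‖E‖ = 1 ∧ ∃ C : NonUnitalStarSubalgebra ℂ A, IsClosed (C : Set A) ∧
    (∀ a, E a ∈ C) ∧ ∀ c ∈ C, E c = c

end

open Filter Topology

noncomputable section

/-! ### Positive functionals -/

section Functionals

/-! For a state ω, idempotency means ω ∘ L_ω = ω. Given this, slicing the coassociativity law (Δ ⊗
id)Δ = (id ⊗ Δ)Δ with ω ⊗ ω ⊗ id yields L_ω² = L_ω (`TensorModel.IsConvolution.comp_self`). Slice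
maps of positive functionals satisfy a Kadison-Schwarz inequality, which passes to L_ω. For x =
L_ω(a)* L_ω(a) it gives x ≤ L_ω(x), while the left Haar weight takes the same value on both sides
when a is square integrable. Faithfulness forces L_ω(x) = x; density and polarization then make the
range of L_ω a C*-algebra (`map_star_mul_of_schwarz_of_weight`,
`isConditionalExpectation_of_idempotent`).

Conversely, let L_ω be a conditional expectation onto C. Slicing with the bounded counit ε sends
Δ(a)(1 ⊗ d), or Δ(a)(d ⊗ 1) on the other side, to ad; such elements span densely, so the slice is
multiplicative and ε is a character (`exists_character`). A Fubini argument and R_ε = id give ω = ε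
∘ L_ω. So ω is contractive and agrees on C with the character ε, which does not vanish there;
functional calculus in C produces a positive contraction u with ω(u) = ε(u) = 1, and a contractive
functional with such a u is a state. Finally ω ∘ L_ω = ε ∘ L_ω² = ω.

The statements about R_ω are the same statements with the tensor legs exchanged: `TensorModel`
records what is needed to slice on one side, and `MinTensor.model` and `MinTensor.flipModel` are its
two instances. Idempotency itself does not see the side, as ω ∘ L_ω = ω ∘ R_ω by Fubini.

Multipliers are never sliced directly. A positive functional f admits positive contractions e for
which f and f(e ·) are close in a strong sense (`IsAlmostUnit`), and (f ⊗ id)Δ(a) is the norm limit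
of the slices of Δ(a)(e ⊗ 1), which lies in A ⊗ A. -/

theorem CStarAlgebra.norm_two_smul_sub_one_le {B : Type*} [CStarAlgebra B] [PartialOrder B]
    [StarOrderedRing B] {u : B} (hu : 0 ≤ u) (hu1 : u ≤ 1) : ‖(2 : ℂ) • u - 1‖ ≤ 1 := by
  have hsa : star u = u := (IsSelfAdjoint.of_nonneg hu).star_eq
  have h2 : u ^ 2 ≤ u ^ 1 := CStarAlgebra.pow_antitone hu hu1 one_le_two
  have hstar : star ((2 : ℂ) • u - 1) = (2 : ℂ) • u - 1 := by simp [hsa]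
  have hsq : star ((2 : ℂ) • u - 1) * ((2 : ℂ) • u - 1) = 1 - (4 : ℝ) • (u ^ 1 - u ^ 2) := by
    rw [hstar]
    have h4 : ((4 : ℝ) • (u ^ 1 - u ^ 2)) = (4 : ℂ) • (u - u * u) := by
      rw [pow_one, pow_two]
      exact (Complex.coe_smul 4 _).symm.trans (by norm_num)
    rw [h4]
    simp only [sub_mul, mul_sub, smul_mul_smul_comm, mul_one, one_mul, smul_sub]
    norm_num
    module
  have hle : star ((2 : ℂ) • u - 1) * ((2 : ℂ) • u - 1) ≤ 1 := by
    rw [hsq, sub_le_self_iff]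
    exact smul_nonneg (by norm_num) (sub_nonneg.2 h2)
  have := (CStarAlgebra.norm_le_one_iff_of_nonneg _ (star_mul_self_nonneg _)).2 hle
  rw [CStarRing.norm_star_mul_self] at this
  nlinarith [norm_nonneg ((2 : ℂ) • u - 1)]

theorem isPositiveFunctional_of_map_one {B : Type*} [CStarAlgebra B] [PartialOrder B]
    [StarOrderedRing B] (f : B →L[ℂ] ℂ) (hf : ‖f‖ ≤ 1) (h1 : f 1 = 1) :
    IsPositiveFunctional f := by
  have hle : ∀ x, ‖f x‖ ≤ ‖x‖ := fun x => by simpa using f.le_of_opNorm_le hf x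
  have him : ∀ a : B, IsSelfAdjoint a → (f a).im = 0 := by
    intro a ha
    -- Shifting a by it enlarges its squared norm by at most t², but moves Im f(a) by the full
    -- amount t.
    have key : ∀ t : ℝ, ((f a).im + t) ^ 2 ≤ ‖a‖ ^ 2 + t ^ 2 := by
      intro t
      have h2 : star (a + (t * Complex.I) • (1 : B)) * (a + (t * Complex.I) • (1 : B)) =
          a * a + ((t ^ 2 : ℝ) : ℂ) • (1 : B) := by
        have hs : star (a + (t * Complex.I) • (1 : B)) = a - (t * Complex.I) • (1 : B) := by
          rw [star_add, ha.star_eq, star_smul, star_one]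
          simp [sub_eq_add_neg]
        rw [hs]
        simp only [sub_mul, mul_add, mul_one, one_mul, smul_mul_assoc, mul_smul_comm]
        have : ((t ^ 2 : ℝ) : ℂ) = - (t * Complex.I * (t * Complex.I)) := by
          push_cast
          linear_combination ((t : ℂ) ^ 2) * Complex.I_mul_I
        rw [this]
        module
      have h3 : ‖a + (t * Complex.I) • (1 : B)‖ ^ 2 ≤ ‖a‖ ^ 2 + t ^ 2 := by
        rw [pow_two, ← CStarRing.norm_star_mul_self, h2]
        refine (norm_add_le _ _).trans ?_
        have h1 : ‖(1 : B)‖ ≤ 1 := by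
          rcases subsingleton_or_nontrivial B with h | h
          · simp [Subsingleton.elim (1 : B) 0]
          · simp
        have h4 : ‖((t ^ 2 : ℝ) : ℂ) • (1 : B)‖ ≤ t ^ 2 := by
          rw [norm_smul, Complex.norm_real, Real.norm_of_nonneg (sq_nonneg t)]
          exact mul_le_of_le_one_right (sq_nonneg t) h1
        have h5 := norm_mul_le a a
        nlinarith
      have h4 : f (a + (t * Complex.I) • (1 : B)) = f a + t * Complex.I := by
        rw [map_add, map_smul, h1, smul_eq_mul, mul_one]
      have h5 := hle (a + (t * Complex.I) • (1 : B))
      rw [h4] at h5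
      have h6 := Complex.abs_im_le_norm (f a + t * Complex.I)
      have h7 : (f a + t * Complex.I).im = (f a).im + t := by simp
      rw [h7] at h6
      have h8 : ((f a).im + t) ^ 2 ≤ ‖a + (t * Complex.I) • (1 : B)‖ ^ 2 := by
        rw [← sq_abs]
        gcongr
        exact h6.trans h5
      exact h8.trans h3
    by_contra hne
    -- For this t the cross term 2t · Im f(a) equals 2‖a‖², which exceeds the available ‖a‖².
    have := key (‖a‖ ^ 2 / (f a).im)
    have h9 : (f a).im * (‖a‖ ^ 2 / (f a).im) = ‖a‖ ^ 2 := by field_simp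
    have h10 : 0 < (f a).im ^ 2 := by positivity
    nlinarith [sq_nonneg ‖a‖]
  intro a ha
  have hsa := IsSelfAdjoint.of_nonneg ha
  rw [Complex.nonneg_iff]
  refine ⟨?_, (him a hsa).symm⟩
  -- Contractivity then places f(a) in the disc of radius ‖a‖ about ‖a‖, hence in the right
  -- half-plane.
  have h2 : ‖algebraMap ℝ B ‖a‖ - a‖ ≤ ‖a‖ := by
    rw [CStarAlgebra.norm_le_iff_le_algebraMap _ (norm_nonneg a)
      (sub_nonneg.2 hsa.le_algebraMap_norm_self)]
    exact sub_le_self _ ha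
  have h3 := (hle _).trans h2
  have h4 : f (algebraMap ℝ B ‖a‖ - a) = ‖a‖ - f a := by
    rw [map_sub, Algebra.algebraMap_eq_smul_one, ← Complex.coe_smul, map_smul, h1, smul_eq_mul,
      mul_one]
  rw [h4] at h3
  have h5 := (Complex.re_le_norm _).trans h3
  simp at h5
  linarith

variable {A : Type*} [NonUnitalCStarAlgebra A] [PartialOrder A] [StarOrderedRing A]

/-- A contractive functional with the value `1` at a positive contraction is positive. -/
theorem isPositiveFunctional_of_apply_eq_one (f : A →L[ℂ] ℂ) (hf : ‖f‖ ≤ 1) {u : A} (hu : 0 ≤ u)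
    (hu1 : ‖u‖ ≤ 1) (hfu : f u = 1) : IsPositiveFunctional f := by
  let i : A →ₗᵢ[ℂ] Unitization ℂ A :=
    ⟨Unitization.inrHom ℂ ℂ A, fun a => Unitization.norm_inr (𝕜 := ℂ) a⟩
  have hi : ∀ a : A, i a = (a : Unitization ℂ A) := fun a => rfl
  -- A Hahn-Banach extension to the unitization; the point is that its value at 1 is forced.
  obtain ⟨g, hg, hgn⟩ := exists_extension_norm_eq (LinearMap.range i.toLinearMap)
    (f ∘L i.equivRange.symm.toContinuousLinearEquiv.toContinuousLinearMap)
  have hgi : ∀ a : A, g (a : Unitization ℂ A) = f a := by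
    intro a
    have := hg (i.equivRange a)
    rw [← hi]
    simpa using this
  have hn : ‖g‖ ≤ 1 := by
    rw [hgn]
    refine ContinuousLinearMap.opNorm_le_bound _ zero_le_one fun x => ?_
    have := f.le_of_opNorm_le hf (i.equivRange.symm x)
    simpa using this
  have h1 : ‖g 1‖ ≤ 1 := by
    simpa using g.le_of_opNorm_le hn 1
  -- The element 2u - 1 is a contraction and g(u) = 1. The closed unit discs about 0 and about 2
  -- meet only at 1, so g(1) = 1.
  have h2 : ‖2 - g 1‖ ≤ 1 := by
    have hI := CStarAlgebra.inr_mem_Icc_iff_norm_le.2 ⟨hu, hu1⟩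
    have h3 := CStarAlgebra.norm_two_smul_sub_one_le hI.1 hI.2
    have h4 := (g.le_of_opNorm_le hn _).trans (by simpa using h3)
    rw [map_sub, map_smul, hgi, hfu] at h4
    simpa using h4
  have h3 : g 1 = 1 := by
    have h4 := (Complex.re_le_norm _).trans h2
    have h5 : (g 1).re = 1 := by
      have := (Complex.re_le_norm _).trans h1
      simp at h4
      linarith
    have h6 : (g 1).im = 0 := by
      have h7 : ‖g 1‖ ^ 2 ≤ 1 := by nlinarith [norm_nonneg (g 1)]
      rw [Complex.sq_norm, Complex.normSq_apply, h5] at h7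
      nlinarith
    exact Complex.ext h5 h6
  intro a ha
  rw [← hgi]
  exact isPositiveFunctional_of_map_one g hn h3 _ (Unitization.inr_nonneg_iff.2 ha)

/-- A norming functional of b*b takes the value 1 at the normalized b*b, which is a positive
contraction, so it is automatically positive. This lets the norm of a slice be tested with positive
functionals, hence with GNS vectors. -/
theorem exists_isPositiveFunctional_apply_star_mul_self (b : A) :
    ∃ g : A →L[ℂ] ℂ, IsPositiveFunctional g ∧ ‖g‖ ≤ 1 ∧ g (star b * b) = (‖b‖ : ℂ) ^ 2 := by
  rcases eq_or_ne b 0 with rfl | hb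
  · exact ⟨0, fun _ _ => le_rfl, by simp, by simp⟩
  have hb' : ‖b‖ ≠ 0 := norm_ne_zero_iff.2 hb
  have hn : ‖star b * b‖ = ‖b‖ ^ 2 := by rw [CStarRing.norm_star_mul_self, pow_two]
  obtain ⟨g, hg, hgb⟩ := exists_dual_vector ℂ (star b * b) (by rw [hn]; positivity)
  rw [hn] at hgb
  refine ⟨g, isPositiveFunctional_of_apply_eq_one g hg.le
    (u := (‖b‖ ^ 2)⁻¹ • (star b * b)) (smul_nonneg (by positivity) (star_mul_self_nonneg b))
    ?_ ?_, hg.le, by simpa using hgb⟩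
  · rw [norm_smul, hn, norm_inv, norm_pow, norm_norm, inv_mul_cancel₀ (by positivity)]
  · rw [← Complex.coe_smul, map_smul, hgb, smul_eq_mul]
    push_cast
    exact inv_mul_cancel₀ (by simpa using hb')

namespace IsPositiveFunctional

variable {f : A →L[ℂ] ℂ}

/-- A positive bounded functional as a positive linear map. -/
def toPositiveLinearMap (hf : IsPositiveFunctional f) : A →ₚ[ℂ] ℂ :=
  PositiveLinearMap.mk₀ f.toLinearMap hf

theorem map_star (hf : IsPositiveFunctional f) (a : A) : f (star a) = star (f a) :=
  StarHomClass.map_star hf.toPositiveLinearMap a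

theorem re_nonneg (hf : IsPositiveFunctional f) (a : A) : 0 ≤ (f (star a * a)).re :=
  (Complex.nonneg_iff.1 (hf _ (star_mul_self_nonneg a))).1

theorem apply_eq_re {A : Type*} [NonUnitalCStarAlgebra A] [PartialOrder A] {f : A →L[ℂ] ℂ}
    (hf : IsPositiveFunctional f) {a : A} (ha : 0 ≤ a) : f a = (f a).re :=
  Complex.ext rfl (Complex.nonneg_iff.1 (hf _ ha)).2.symm

theorem mono (hf : IsPositiveFunctional f) {a b : A} (hab : a ≤ b) : (f a).re ≤ (f b).re := by
  have := (Complex.nonneg_iff.1 (hf _ (sub_nonneg.2 hab))).1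
  simpa using this

theorem cauchy_schwarz (hf : IsPositiveFunctional f) (a b : A) :
    ‖f (star a * b)‖ ^ 2 ≤ (f (star a * a)).re * (f (star b * b)).re := by
  set g := hf.toPositiveLinearMap
  have h := norm_inner_le_norm (𝕜 := ℂ) (g.toPreGNS a) (g.toPreGNS b)
  have ha : ‖g.toPreGNS a‖ ^ 2 = (f (star a * a)).re := by
    have := congrArg Complex.re (g.preGNS_norm_sq (g.toPreGNS a))
    rw [← Complex.ofReal_pow, Complex.ofReal_re] at this
    exact this
  have hb : ‖g.toPreGNS b‖ ^ 2 = (f (star b * b)).re := by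
    have := congrArg Complex.re (g.preGNS_norm_sq (g.toPreGNS b))
    rw [← Complex.ofReal_pow, Complex.ofReal_re] at this
    exact this
  rw [← ha, ← hb, ← mul_pow]
  exact pow_le_pow_left₀ (norm_nonneg _) h 2

theorem re_apply_le {A : Type*} [NonUnitalCStarAlgebra A] (f : A →L[ℂ] ℂ) {a : A}
    {c : ℝ} (ha : ‖a‖ ≤ c) : (f a).re ≤ ‖f‖ * c :=
  (Complex.re_le_norm _).trans (f.le_opNorm_of_le ha)

end IsPositiveFunctional

theorem CStarAlgebra.mul_self_le_self {x : A} (hx : 0 ≤ x) (hx1 : ‖x‖ ≤ 1) : x * x ≤ x := by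
  have hI := CStarAlgebra.inr_mem_Icc_iff_norm_le.2 ⟨hx, hx1⟩
  have h2 := CStarAlgebra.pow_antitone hI.1 hI.2 one_le_two
  have hsa := IsSelfAdjoint.of_nonneg hx
  rw [← Unitization.inr_le_iff _ _ (by rw [IsSelfAdjoint, star_mul, hsa.star_eq]) hsa]
  simpa [pow_two] using h2

namespace IsPositiveFunctional

variable {f : A →L[ℂ] ℂ}

theorem norm_apply_sq_le (hf : IsPositiveFunctional f) (a : A) :
    ‖f a‖ ^ 2 ≤ ‖f‖ * (f (star a * a)).re := by
  have hl := CStarAlgebra.increasingApproximateUnit A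
  have h1 : Tendsto (fun e => ‖f (e * a)‖ ^ 2) (CStarAlgebra.approximateUnit A)
      (𝓝 (‖f a‖ ^ 2)) :=
    (((f.continuous.tendsto _).comp (hl.tendsto_mul_right a)).norm.pow 2)
  refine le_of_tendsto h1 ?_
  filter_upwards [hl.eventually_nonneg, hl.eventually_norm] with e he he1
  have hs := (IsSelfAdjoint.of_nonneg he).star_eq
  have h2 := hf.cauchy_schwarz e a
  rw [hs] at h2
  refine h2.trans (mul_le_mul_of_nonneg_right ?_ (hf.re_nonneg a))
  have h3 : ‖e * e‖ ≤ 1 := (norm_mul_le _ _).trans (by nlinarith [norm_nonneg e])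
  simpa using re_apply_le f h3

/-- Choose e with f(e) within δ of the supremum of f over positive contractions. Any contraction e'
≥ e then satisfies f((e' - e)²) ≤ f(e' - e) ≤ δ, so Cauchy-Schwarz bounds f((e' - e)a); let e' run
through the approximate unit. -/
theorem exists_norm_sub_mul_left_sq_le (hf : IsPositiveFunctional f) {δ : ℝ} (hδ : 0 < δ) :
    ∃ e : A, 0 ≤ e ∧ ‖e‖ ≤ 1 ∧ ∀ a, ‖f a - f (e * a)‖ ^ 2 ≤ δ * (f (star a * a)).re := by
  let s : Set ℝ := (fun e => (f e).re) '' {e : A | 0 ≤ e ∧ ‖e‖ ≤ 1}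
  have hs : BddAbove s := ⟨‖f‖, by
    rintro _ ⟨e, he, rfl⟩
    simpa using re_apply_le f he.2⟩
  have hne : s.Nonempty := ⟨_, 0, ⟨le_rfl, by simp⟩, rfl⟩
  obtain ⟨_, ⟨e₀, he₀, rfl⟩, hlt⟩ := exists_lt_of_lt_csSup hne (sub_lt_self (sSup s) hδ)
  -- The canonical approximate unit has a basis of sets e' ≥ e with ‖e‖ strictly below 1, so e₀ is
  -- scaled down slightly.
  obtain ⟨e, he, he1, hlt⟩ : ∃ e : A, 0 ≤ e ∧ ‖e‖ < 1 ∧ sSup s - δ < (f e).re := by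
    have hc : Continuous fun r : ℝ => (f (r • e₀)).re := by fun_prop
    have h1 : ∀ᶠ r in 𝓝[<] (1 : ℝ), sSup s - δ < (f (r • e₀)).re := by
      refine (hc.tendsto 1).mono_left nhdsWithin_le_nhds |>.eventually_const_lt ?_
      simpa using hlt
    have h2 : ∀ᶠ r in 𝓝[<] (1 : ℝ), 0 < r :=
      nhdsWithin_le_nhds (lt_mem_nhds zero_lt_one)
    obtain ⟨r, hr, hr0, hr1⟩ := (h1.and (h2.and self_mem_nhdsWithin)).exists
    refine ⟨r • e₀, smul_nonneg hr0.le he₀.1, ?_, hr⟩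
    rw [norm_smul, Real.norm_of_nonneg hr0.le]
    exact (mul_le_of_le_one_right hr0.le he₀.2).trans_lt hr1
  refine ⟨e, he, he1.le, fun a => ?_⟩
  have hl := CStarAlgebra.increasingApproximateUnit A
  have h1 : Tendsto (fun e' => ‖f (e' * a) - f (e * a)‖ ^ 2) (CStarAlgebra.approximateUnit A)
      (𝓝 (‖f a - f (e * a)‖ ^ 2)) :=
    ((((f.continuous.tendsto _).comp (hl.tendsto_mul_right a)).sub_const _).norm.pow 2)
  refine le_of_tendsto h1 ?_
  filter_upwards [(CStarAlgebra.hasBasis_approximateUnit A).mem_of_mem ⟨he, he1⟩] with e' he'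
  have hle : e ≤ e' := he'.1
  have hn : ‖e'‖ ≤ 1 := by simpa using he'.2
  have h0 : 0 ≤ e' - e := sub_nonneg.2 hle
  have hn' : ‖e' - e‖ ≤ 1 :=
    (CStarAlgebra.norm_le_norm_of_nonneg_of_le h0 (sub_le_self _ he)).trans hn
  have h2 := hf.cauchy_schwarz (e' - e) a
  rw [(IsSelfAdjoint.of_nonneg h0).star_eq, sub_mul, map_sub] at h2
  refine h2.trans (mul_le_mul_of_nonneg_right ?_ (hf.re_nonneg a))
  refine (hf.mono (CStarAlgebra.mul_self_le_self h0 hn')).trans ?_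
  have h3 : (f e').re ≤ sSup s := le_csSup hs ⟨e', ⟨he.trans hle, hn⟩, rfl⟩
  rw [map_sub, Complex.sub_re]
  linarith

end IsPositiveFunctional

end Functionals

/-! ### Multipliers -/

namespace DoubleCentralizer

variable {E : Type*} [NonUnitalCStarAlgebra E]

theorem _root_.CStarAlgebra.eq_of_forall_mul_left {x y : E} (h : ∀ z, z * x = z * y) : x = y := by
  have := h (star (x - y))
  rwa [← sub_eq_zero, ← mul_sub, CStarRing.star_mul_self_eq_zero_iff, sub_eq_zero] at this

theorem _root_.CStarAlgebra.eq_of_forall_mul_right {x y : E} (h : ∀ z, x * z = y * z) : x = y := by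
  have := h (star (x - y))
  rwa [← sub_eq_zero, ← sub_mul, CStarRing.mul_star_self_eq_zero_iff, sub_eq_zero] at this

theorem ext_of_fst {m m' : 𝓜(ℂ, E)} (h : ∀ x, m.fst x = m'.fst x) : m = m' := by
  refine DoubleCentralizer.ext ℂ E _ _ (Prod.ext (ContinuousLinearMap.ext h)
    (ContinuousLinearMap.ext fun x => ?_))
  exact CStarAlgebra.eq_of_forall_mul_right fun y => by
    rw [m.central, m'.central, h]

theorem fst_apply_mul (m : 𝓜(ℂ, E)) (x y : E) : m.fst (x * y) = m.fst x * y :=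
  CStarAlgebra.eq_of_forall_mul_left fun z => by
    rw [← m.central, ← mul_assoc, ← mul_assoc, m.central]

theorem star_fst_mul (m : 𝓜(ℂ, E)) (x y : E) : star (m.fst x) * y = star x * (star m).fst y := by
  rw [← (star m).central, star_snd, star_star]

theorem mul_coe (m : 𝓜(ℂ, E)) (x : E) : m * (x : 𝓜(ℂ, E)) = (m.fst x : E) :=
  ext_of_fst fun y => by simp [fst_apply_mul]

theorem coe_mul' (m : 𝓜(ℂ, E)) (x : E) : (x : 𝓜(ℂ, E)) * m = (m.snd x : E) :=
  ext_of_fst fun y => by simp [m.central]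

theorem coe_mul_coe (x y : E) : (x : 𝓜(ℂ, E)) * (y : 𝓜(ℂ, E)) = (x * y : E) := by
  simp [mul_coe]

theorem star_coe (x : E) : star (x : 𝓜(ℂ, E)) = (star x : E) :=
  (map_star (coeHom (𝕜 := ℂ) (A := E)) x).symm

theorem coe_add (x y : E) : ((x + y : E) : 𝓜(ℂ, E)) = x + y :=
  map_add (coeHom (𝕜 := ℂ) (A := E)) x y

theorem coe_smul (c : ℂ) (x : E) : ((c • x : E) : 𝓜(ℂ, E)) = c • (x : 𝓜(ℂ, E)) :=
  map_smul (coeHom (𝕜 := ℂ) (A := E)) c x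

theorem norm_coe (x : E) : ‖(x : 𝓜(ℂ, E))‖ = ‖x‖ := by
  rw [← norm_fst, coe_fst]
  exact ContinuousLinearMap.opNorm_mul_apply ℂ E x

theorem isometry_coe : Isometry (DoubleCentralizer.coe ℂ : E → 𝓜(ℂ, E)) :=
  AddMonoidHomClass.isometry_of_norm (coeHom (𝕜 := ℂ) (A := E)) norm_coe

end DoubleCentralizer

/-- A positive semidefinite matrix is a sum of rank-one matrices, and each of these turns the double
sum into a single square x*x. -/
theorem Matrix.PosSemidef.sum_smul_star_mul_nonneg {B ι : Type*} [NonUnitalCStarAlgebra B]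
    [PartialOrder B] [StarOrderedRing B] [Fintype ι] {M : Matrix ι ι ℂ} (hM : M.PosSemidef)
    (b : ι → B) : 0 ≤ ∑ i, ∑ j, M i j • (star (b i) * b j) := by
  obtain ⟨m, v, hv⟩ := Matrix.posSemidef_iff_eq_sum_vecMulVec.1 hM
  have : ∑ i, ∑ j, M i j • (star (b i) * b j) =
      ∑ k, star (∑ i, star (v k i) • b i) * ∑ j, star (v k j) • b j := by
    simp only [star_sum, Finset.sum_mul_sum, star_smul, star_star, smul_mul_smul_comm]
    rw [Finset.sum_comm (s := (Finset.univ : Finset (Fin m)))]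
    refine Finset.sum_congr rfl fun i _ => ?_
    rw [Finset.sum_comm (s := (Finset.univ : Finset (Fin m)))]
    refine Finset.sum_congr rfl fun j _ => ?_
    simp only [hv, Matrix.sum_apply, Matrix.vecMulVec_apply, Finset.sum_smul, Pi.star_apply]
  rw [this]
  exact Finset.sum_nonneg fun k _ => star_mul_self_nonneg _

/-! ### Models of tensor products -/

/-! ### Functionals dominated by a positive functional -/

section Dominated

variable {A B : Type*} [NonUnitalCStarAlgebra A] [PartialOrder A] [StarOrderedRing A]
  [NonUnitalCStarAlgebra B] [PartialOrder B] [StarOrderedRing B]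

/-- The scalar domination says exactly that the matrix K f(aᵢ* aⱼ) - conj(g(aᵢ)) g(aⱼ) is positive
semidefinite: its quadratic form is K f(x*x) - |g(x)|² at x = ∑ vᵢ aᵢ. With g = f this becomes
Kadison-Schwarz for slices; with g = f - f(e ·) it becomes the estimate for almost units. -/
theorem IsPositiveFunctional.star_mul_le_of_dominated {f : A →L[ℂ] ℂ} (hf : IsPositiveFunctional f)
    {g : A →ₗ[ℂ] ℂ} {K : ℝ} (hg : ∀ a, ‖g a‖ ^ 2 ≤ K * (f (star a * a)).re) {ι : Type*} [Fintype ι]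
    (a : ι → A) (b : ι → B) :
    star (∑ i, g (a i) • b i) * ∑ i, g (a i) • b i ≤
      (K : ℂ) • ∑ i, ∑ j, f (star (a i) * a j) • (star (b i) * b j) := by
  let M : Matrix ι ι ℂ := fun i j => (K : ℂ) * f (star (a i) * a j) - star (g (a i)) * g (a j)
  have hM : M.PosSemidef := by
    refine Matrix.PosSemidef.of_dotProduct_mulVec_nonneg (Matrix.IsHermitian.ext fun i j => ?_)
      fun v => ?_
    · change star ((K : ℂ) * f (star (a j) * a i) - star (g (a j)) * g (a i)) =
        (K : ℂ) * f (star (a i) * a j) - star (g (a i)) * g (a j)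
      rw [star_sub, star_mul', star_mul', ← hf.map_star, star_mul, star_star, star_star,
        mul_comm (g (a j)), Complex.star_def, Complex.conj_ofReal]
    · have hfx : f (star (∑ i, v i • a i) * ∑ i, v i • a i) =
          ∑ i, ∑ j, star (v i) * v j * f (star (a i) * a j) := by
        simp only [star_sum, Finset.sum_mul_sum, star_smul, smul_mul_smul_comm, map_sum, map_smul,
          smul_eq_mul]
      have hgx : star (g (∑ i, v i • a i)) * g (∑ i, v i • a i) =
          ∑ i, ∑ j, star (v i) * v j * (star (g (a i)) * g (a j)) := by
        simp only [map_sum, map_smul, smul_eq_mul, star_sum, Finset.sum_mul_sum, star_mul']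
        exact Finset.sum_congr rfl fun i _ => Finset.sum_congr rfl fun j _ => by ring
      have h1 : star v ⬝ᵥ (M.mulVec v) =
          (K : ℂ) * f (star (∑ i, v i • a i) * ∑ i, v i • a i) -
            star (g (∑ i, v i • a i)) * g (∑ i, v i • a i) := by
        rw [hfx, hgx]
        simp only [dotProduct, Matrix.mulVec, M, Finset.mul_sum, ← Finset.sum_sub_distrib,
          Pi.star_apply]
        exact Finset.sum_congr rfl fun i _ => Finset.sum_congr rfl fun j _ => by ring
      rw [h1]
      set x := ∑ i, v i • a i
      rw [hf.apply_eq_re (star_mul_self_nonneg x), Complex.star_def,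
        ← Complex.normSq_eq_conj_mul_self, Complex.normSq_eq_norm_sq, ← Complex.ofReal_mul, ← Complex.ofReal_sub, Complex.zero_le_real]
      linarith [hg x]
  have h2 := hM.sum_smul_star_mul_nonneg b
  rw [← sub_nonneg]
  convert h2 using 1
  simp only [M, star_sum, Finset.sum_mul_sum, star_smul, smul_mul_smul_comm, sub_smul,
    Finset.sum_sub_distrib, Finset.smul_sum, smul_smul]

/-- `e` almost acts as a unit for the functional `f`. -/
def IsAlmostUnit (f : A →L[ℂ] ℂ) (δ : ℝ) (e : A) : Prop :=
  0 ≤ e ∧ ‖e‖ ≤ 1 ∧ ∀ a, ‖f a - f (e * a)‖ ^ 2 ≤ δ ^ 2 / (‖f‖ + 1) * (f (star a * a)).re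

theorem IsPositiveFunctional.exists_isAlmostUnit {f : A →L[ℂ] ℂ} (hf : IsPositiveFunctional f)
    {δ : ℝ} (hδ : 0 < δ) : ∃ e, IsAlmostUnit f δ e :=
  hf.exists_norm_sub_mul_left_sq_le (by positivity)

theorem IsAlmostUnit.norm_sub_le {f : A →L[ℂ] ℂ} (hf : IsPositiveFunctional f) {δ : ℝ} (hδ : 0 ≤ δ)
    {e : A} (he : IsAlmostUnit f δ e) (a : A) : ‖f a - f (a * e)‖ ≤ δ * ‖a‖ := by
  have h := he.2.2 (star a)
  have hs : e * star a = star (a * e) := by rw [star_mul, (IsSelfAdjoint.of_nonneg he.1).star_eq]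
  -- The defining estimate concerns multiplication by e on the left; adjoints move it to the right.
  rw [hs, hf.map_star, hf.map_star, ← star_sub, norm_star, star_star] at h
  have h1 : (f (a * star a)).re ≤ (‖f‖ + 1) * ‖a‖ ^ 2 := by
    have := IsPositiveFunctional.re_apply_le f (a := a * star a) (c := ‖a‖ ^ 2)
      (by rw [CStarRing.norm_self_mul_star, pow_two])
    nlinarith [sq_nonneg ‖a‖]
  refine (sq_le_sq₀ (norm_nonneg _) (by positivity)).1 ?_
  refine h.trans ((mul_le_mul_of_nonneg_left h1 (by positivity)).trans_eq ?_)
  field_simp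

end Dominated

/-- A C*-algebra `T` with bilinear elementary tensors that has the properties of the spatial tensor
product of `A` and `B` needed for slicing with positive functionals of `A`. -/
structure TensorModel (A B T : Type*) [NonUnitalCStarAlgebra A] [PartialOrder A]
    [NonUnitalCStarAlgebra B] [NonUnitalCStarAlgebra T] where
  tmul : A →ₗ[ℂ] B →ₗ[ℂ] T
  mul_tmul : ∀ a a' b b', tmul a b * tmul a' b' = tmul (a * a') (b * b')
  star_tmul : ∀ a b, star (tmul a b) = tmul (star a) (star b)
  norm_tmul_le : ∀ a b, ‖tmul a b‖ ≤ ‖a‖ * ‖b‖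
  denseRange : DenseRange (TensorProduct.lift tmul)
  inl : A → 𝓜(ℂ, T)
  inr : B → 𝓜(ℂ, T)
  inl_fst : ∀ c a b, (inl c).fst (tmul a b) = tmul (c * a) b
  inr_fst : ∀ a c b, (inr c).fst (tmul a b) = tmul a (c * b)
  slice_bound : ∀ f : A →L[ℂ] ℂ, IsPositiveFunctional f → ∀ z : A ⊗[ℂ] B,
    ‖TensorProduct.lid ℂ B (TensorProduct.map f.toLinearMap LinearMap.id z)‖ ≤
      ‖f‖ * ‖TensorProduct.lift tmul z‖

namespace TensorModel

section Basic

variable {A B T : Type*} [NonUnitalCStarAlgebra A] [PartialOrder A] [NonUnitalCStarAlgebra B]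
  [NonUnitalCStarAlgebra T] (X : TensorModel A B T)

theorem induction {p : T → Prop} (hc : IsClosed {t | p t}) (ht : ∀ a b, p (X.tmul a b))
    (ha : ∀ s t, p s → p t → p (s + t)) (t : T) : p t := by
  refine X.denseRange.induction_on t hc fun z => ?_
  induction z using TensorProduct.induction_on with
  | zero => simpa using ht 0 0
  | tmul a b => simpa using ht a b
  | add z w hz hw => rw [map_add]; exact ha _ _ hz hw

theorem clm_ext {F : Type*} [NormedAddCommGroup F] [NormedSpace ℂ F] {S S' : T →L[ℂ] F}
    (h : ∀ a b, S (X.tmul a b) = S' (X.tmul a b)) : S = S' :=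
  ContinuousLinearMap.ext fun t => X.induction (p := fun t => S t = S' t)
    (isClosed_eq S.continuous S'.continuous) h (fun s t hs ht => by rw [map_add, map_add, hs, ht]) t

theorem multiplier_ext {m m' : 𝓜(ℂ, T)} (h : ∀ a b, m.fst (X.tmul a b) = m'.fst (X.tmul a b)) :
    m = m' :=
  DoubleCentralizer.ext_of_fst fun x => by rw [X.clm_ext h]

theorem inl_mul_inr (a : A) (b : B) : X.inl a * X.inr b = (X.tmul a b : T) :=
  X.multiplier_ext fun c d => by
    simp [X.inl_fst, X.inr_fst, X.mul_tmul]

theorem inr_mul_inl (a : A) (b : B) : X.inr b * X.inl a = (X.tmul a b : T) :=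
  X.multiplier_ext fun c d => by
    simp [X.inl_fst, X.inr_fst, X.mul_tmul]

theorem inl_mul (a a' : A) : X.inl (a * a') = X.inl a * X.inl a' :=
  X.multiplier_ext fun c d => by simp [X.inl_fst, mul_assoc]

theorem inr_mul (b b' : B) : X.inr (b * b') = X.inr b * X.inr b' :=
  X.multiplier_ext fun c d => by simp [X.inr_fst, mul_assoc]

theorem inr_add (b b' : B) : X.inr (b + b') = X.inr b + X.inr b' :=
  X.multiplier_ext fun c d => by simp [X.inr_fst, add_mul]

theorem inr_smul (r : ℂ) (b : B) : X.inr (r • b) = r • X.inr b :=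
  X.multiplier_ext fun c d => by simp [X.inr_fst, smul_mul_assoc]

theorem eq_of_forall_tmul_mul {x y : T} (h : ∀ a b, X.tmul a b * x = X.tmul a b * y) : x = y :=
  CStarAlgebra.eq_of_forall_mul_left fun z => X.induction (p := fun z => z * x = z * y)
    (isClosed_eq (by fun_prop) (by fun_prop)) h
    (fun s t hs ht => by rw [add_mul, add_mul, hs, ht]) z

theorem star_inl (a : A) : star (X.inl a) = X.inl (star a) :=
  X.multiplier_ext fun c d => X.eq_of_forall_tmul_mul fun c' d' => by
    have := DoubleCentralizer.star_fst_mul (X.inl a) (X.tmul (star c') (star d')) (X.tmul c d)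
    simpa [X.inl_fst, X.star_tmul, X.mul_tmul, mul_assoc] using this.symm

theorem star_inr (b : B) : star (X.inr b) = X.inr (star b) :=
  X.multiplier_ext fun c d => X.eq_of_forall_tmul_mul fun c' d' => by
    have := DoubleCentralizer.star_fst_mul (X.inr b) (X.tmul (star c') (star d')) (X.tmul c d)
    simpa [X.inr_fst, X.star_tmul, X.mul_tmul, mul_assoc] using this.symm

theorem inr_snd (a : A) (c b : B) : (X.inr c).snd (X.tmul a b) = X.tmul a (b * c) := by
  have := DoubleCentralizer.star_snd (X.inr (star c)) (X.tmul a b)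
  simpa [X.star_inr, X.star_tmul, X.inr_fst] using this

theorem inl_snd (c a : A) (b : B) : (X.inl c).snd (X.tmul a b) = X.tmul (a * c) b := by
  have := DoubleCentralizer.star_snd (X.inl (star c)) (X.tmul a b)
  simpa [X.star_inl, X.star_tmul, X.inl_fst] using this

/-- `S` is the slice map `f ⊗ id`. -/
def IsSlice (f : A →L[ℂ] ℂ) (S : T →L[ℂ] B) : Prop :=
  ∀ a b, S (X.tmul a b) = f a • b

theorem exists_isSlice {f : A →L[ℂ] ℂ} (hf : IsPositiveFunctional f) :
    ∃ S : T →L[ℂ] B, X.IsSlice f S ∧ ‖S‖ ≤ ‖f‖ := by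
  refine ⟨LinearMap.extendOfNorm ((TensorProduct.lid ℂ B).toLinearMap ∘ₗ
    TensorProduct.map f.toLinearMap LinearMap.id) (TensorProduct.lift X.tmul), fun a b => ?_,
    LinearMap.opNorm_extendOfNorm_le X.denseRange (norm_nonneg f) (X.slice_bound f hf)⟩
  have := LinearMap.extendOfNorm_eq (f := (TensorProduct.lid ℂ B).toLinearMap ∘ₗ
    TensorProduct.map f.toLinearMap LinearMap.id) X.denseRange ⟨_, X.slice_bound f hf⟩ (a ⊗ₜ[ℂ] b)
  simpa using this

namespace IsSlice

variable {X} {f : A →L[ℂ] ℂ} {S : T →L[ℂ] B}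

theorem unique {S' : T →L[ℂ] B} (hS : X.IsSlice f S) (hS' : X.IsSlice f S') : S = S' :=
  X.clm_ext fun a b => by rw [hS, hS']

theorem norm_le (hS : X.IsSlice f S) (hf : IsPositiveFunctional f) : ‖S‖ ≤ ‖f‖ := by
  obtain ⟨S', hS', h⟩ := X.exists_isSlice hf
  rwa [hS.unique hS']

theorem apply_inr_fst (hS : X.IsSlice f S) (d : B) (t : T) : S ((X.inr d).fst t) = d * S t := by
  refine X.induction (p := fun t => S ((X.inr d).fst t) = d * S t)
    (isClosed_eq (by fun_prop) (by fun_prop)) (fun a b => ?_) (fun s t hs ht => ?_) t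
  · rw [X.inr_fst, hS, hS, mul_smul_comm]
  · rw [map_add, map_add, hs, ht, map_add, mul_add]

theorem apply_inr_snd (hS : X.IsSlice f S) (d : B) (t : T) : S ((X.inr d).snd t) = S t * d := by
  refine X.induction (p := fun t => S ((X.inr d).snd t) = S t * d)
    (isClosed_eq (by fun_prop) (by fun_prop)) (fun a b => ?_) (fun s t hs ht => ?_) t
  · rw [X.inr_snd, hS, hS, smul_mul_assoc]
  · rw [map_add, map_add, hs, ht, map_add, add_mul]

theorem comp_inl_fst (hS : X.IsSlice f S) (e : A) :
    X.IsSlice (f ∘L ContinuousLinearMap.mul ℂ A e) (S ∘L (X.inl e).fst) := fun a b => by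
  simp [X.inl_fst, hS _]

end IsSlice

end Basic

section Star

variable {A B T : Type*} [NonUnitalCStarAlgebra A] [PartialOrder A] [StarOrderedRing A]
  [NonUnitalCStarAlgebra B] [NonUnitalCStarAlgebra T] {X : TensorModel A B T}

theorem IsSlice.map_star {f : A →L[ℂ] ℂ} {S : T →L[ℂ] B} (hS : X.IsSlice f S)
    (hf : IsPositiveFunctional f) (t : T) : S (star t) = star (S t) := by
  refine X.induction (p := fun t => S (star t) = star (S t))
    (isClosed_eq (by fun_prop) (by fun_prop)) (fun a b => ?_) (fun s t hs ht => ?_) t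
  · rw [X.star_tmul, hS, hS, hf.map_star, star_smul]
  · rw [star_add, map_add, map_add, hs, ht, star_add]

end Star

section Positive

variable {A B T : Type*} [NonUnitalCStarAlgebra A] [PartialOrder A] [StarOrderedRing A]
  [NonUnitalCStarAlgebra B] [PartialOrder B] [StarOrderedRing B]
  [NonUnitalCStarAlgebra T] {X : TensorModel A B T}

namespace IsSlice

variable {f : A →L[ℂ] ℂ} {S : T →L[ℂ] B}

/-- Both sides are continuous in t, so it suffices to treat finite sums of elementary tensors, where
this is the matrix inequality for dominated functionals. -/
theorem dominated (hS : X.IsSlice f S) (hf : IsPositiveFunctional f) {g : A →L[ℂ] ℂ}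
    {S' : T →L[ℂ] B} (hS' : X.IsSlice g S') {K : ℝ} (hg : ∀ a, ‖g a‖ ^ 2 ≤ K * (f (star a * a)).re)
    (t : T) : star (S' t) * S' t ≤ (K : ℂ) • S (star t * t) := by
  refine X.denseRange.induction_on t (isClosed_le (by fun_prop) (by fun_prop)) fun z => ?_
  obtain ⟨s, hs⟩ := TensorProduct.exists_finset z
  have hz : TensorProduct.lift X.tmul z = ∑ i : s, X.tmul i.1.1 i.1.2 := by
    rw [hs, map_sum, ← Finset.sum_coe_sort]
    simp
  have h := hf.star_mul_le_of_dominated (g := g.toLinearMap) hg (fun i : s => i.1.1)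
    (fun i : s => i.1.2)
  rw [hz]
  simp only [star_sum, Finset.sum_mul_sum, X.star_tmul, X.mul_tmul, map_sum, hS _, hS' _]
  simp only [star_sum, Finset.sum_mul_sum] at h
  exact h

/-- The Kadison-Schwarz inequality for slice maps. -/
theorem schwarz (hS : X.IsSlice f S) (hf : IsPositiveFunctional f) (t : T) :
    star (S t) * S t ≤ (‖f‖ : ℂ) • S (star t * t) :=
  hS.dominated hf hS hf.norm_apply_sq_le t

/-- The map t ↦ S(t) - S((e ⊗ 1)t) is the slice of f - f(e ·), a functional dominated by a small
multiple of f. Domination turns this into a norm estimate uniform in t, and adjoints give the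
version with e on the right. -/
theorem norm_sub_inl_le (hS : X.IsSlice f S) (hf : IsPositiveFunctional f) {δ : ℝ} (hδ : 0 ≤ δ)
    {e : A} (he : IsAlmostUnit f δ e) (t : T) : ‖S t - S ((X.inl e).snd t)‖ ≤ δ * ‖t‖ := by
  have key : ∀ t, ‖S t - S ((X.inl e).fst t)‖ ≤ δ * ‖t‖ := by
    intro t
    have hS' : X.IsSlice (f - f ∘L ContinuousLinearMap.mul ℂ A e) (S - S ∘L (X.inl e).fst) :=
      fun a b => by
        have := hS.comp_inl_fst e a b
        simp_all [hS a b, sub_smul]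
    have h := hS.dominated hf hS' he.2.2 t
    have h2 := CStarAlgebra.norm_le_norm_of_nonneg_of_le (star_mul_self_nonneg _) h
    rw [CStarRing.norm_star_mul_self, norm_smul, Complex.norm_real,
      Real.norm_of_nonneg (by positivity)] at h2
    refine (sq_le_sq₀ (norm_nonneg _) (by positivity)).1 ?_
    have h3 : ‖S (star t * t)‖ ≤ (‖f‖ + 1) * ‖t‖ ^ 2 := by
      refine (S.le_of_opNorm_le (hS.norm_le hf) _).trans ?_
      rw [CStarRing.norm_star_mul_self, ← pow_two]
      gcongr
      linarith
    calc _ = ‖(S - S ∘L (X.inl e).fst) t‖ * ‖(S - S ∘L (X.inl e).fst) t‖ := pow_two _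
      _ ≤ _ := h2
      _ ≤ δ ^ 2 / (‖f‖ + 1) * ((‖f‖ + 1) * ‖t‖ ^ 2) := by gcongr
      _ = _ := by field_simp
  have h := key (star t)
  have hs : star ((X.inl e).snd t) = (X.inl e).fst (star t) := by
    have := DoubleCentralizer.star_fst (X.inl e) (star t)
    rwa [X.star_inl, (IsSelfAdjoint.of_nonneg he.1).star_eq, star_star, eq_comm] at this
  rwa [← hs, hS.map_star hf, hS.map_star hf, ← star_sub, norm_star, norm_star] at h

end IsSlice

end Positive

end TensorModel

/-! ### Convolution operators -/

namespace TensorModel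

section InrHom

variable {A B T : Type*} [NonUnitalCStarAlgebra A] [PartialOrder A] [NonUnitalCStarAlgebra B]
  [NonUnitalCStarAlgebra T] (X : TensorModel A B T)

/-- The embedding `b ↦ 1 ⊗ b` as a *-homomorphism. -/
def inrHom : B →⋆ₙₐ[ℂ] 𝓜(ℂ, T) where
  toFun := X.inr
  map_smul' := X.inr_smul
  map_zero' := by simpa using X.inr_smul 0 0
  map_add' := X.inr_add
  map_mul' := X.inr_mul
  map_star' b := (X.star_inr b).symm

theorem norm_inr_le (b : B) : ‖X.inr b‖ ≤ ‖b‖ :=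
  NonUnitalStarAlgHom.norm_apply_le X.inrHom b

end InrHom

theorem _root_.CStarAlgebra.norm_le_of_forall_mul {A : Type*} [NonUnitalCStarAlgebra A] {y : A}
    {C : ℝ} (hC : 0 ≤ C) (h : ∀ d, ‖y * d‖ ≤ C * ‖d‖) : ‖y‖ ≤ C := by
  rw [← ContinuousLinearMap.opNorm_mul_apply ℂ A y]
  exact ContinuousLinearMap.opNorm_le_bound _ hC h

theorem _root_.CStarAlgebra.tendsto_mul_mul_approximateUnit {A : Type*} [NonUnitalCStarAlgebra A]
    [PartialOrder A] [StarOrderedRing A] (y : A) :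
    Tendsto (fun e : A => e * y * e) (CStarAlgebra.approximateUnit A) (𝓝 y) := by
  have hl := CStarAlgebra.increasingApproximateUnit A
  rw [tendsto_iff_norm_sub_tendsto_zero]
  have hr := tendsto_iff_norm_sub_tendsto_zero.1 (hl.tendsto_mul_right y)
  have hl' := tendsto_iff_norm_sub_tendsto_zero.1 (hl.tendsto_mul_left y)
  refine squeeze_zero' (Eventually.of_forall fun _ => norm_nonneg _) ?_
    (by simpa using hl'.add hr)
  filter_upwards [hl.eventually_norm] with e he
  have h2 : e * y * e - y = e * (y * e - y) + (e * y - y) := by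
    rw [mul_sub, mul_assoc]; abel
  rw [h2]
  refine (norm_add_le _ _).trans (add_le_add_left ((norm_mul_le _ _).trans ?_) _)
  exact mul_le_of_le_one_left (norm_nonneg _) he

theorem _root_.CStarAlgebra.nonneg_of_forall_star_mul_mul {A : Type*} [NonUnitalCStarAlgebra A]
    [PartialOrder A] [StarOrderedRing A] {y : A} (h : ∀ d, 0 ≤ star d * y * d) : 0 ≤ y := by
  refine ge_of_tendsto (CStarAlgebra.tendsto_mul_mul_approximateUnit y) ?_
  filter_upwards [(CStarAlgebra.increasingApproximateUnit A).eventually_star_eq] with e he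
  simpa [he] using h e

variable {A T : Type*} [NonUnitalCStarAlgebra A] [PartialOrder A]
  [NonUnitalCStarAlgebra T] (X : TensorModel A A T) (Δ : A →⋆ₙₐ[ℂ] 𝓜(ℂ, T))

/-- The elements `Δ(a)(1 ⊗ d)` and `Δ(a)(d ⊗ 1)` belong to the tensor product. -/
def IsRegular : Prop :=
  ∀ a d, (∃ t : T, (t : 𝓜(ℂ, T)) = Δ a * X.inr d) ∧ ∃ t : T, (t : 𝓜(ℂ, T)) = Δ a * X.inl d

/-- `L` is the convolution operator `S ∘ Δ`, where `S` is a slice map. -/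
def IsConvolution (S : T →L[ℂ] A) (L : A →L[ℂ] A) : Prop :=
  ∀ a d : A, ∃ t : T, (t : 𝓜(ℂ, T)) = Δ a * X.inr d ∧ L a * d = S t

variable {X Δ}

theorem norm_le_of_coe_eq {a d : A} {t : T} (ht : (t : 𝓜(ℂ, T)) = Δ a * X.inr d) :
    ‖t‖ ≤ ‖a‖ * ‖d‖ := by
  rw [← DoubleCentralizer.norm_coe, ht]
  exact (norm_mul_le _ _).trans (mul_le_mul (NonUnitalStarAlgHom.norm_apply_le Δ a)
    (X.norm_inr_le d) (norm_nonneg _) (norm_nonneg _))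

/-- The two legs commute: Δ(a)(e ⊗ 1)(1 ⊗ d) = Δ(a)(1 ⊗ d)(e ⊗ 1). This compares the approximants
S(Δ(a)(e ⊗ 1)) of the convolution with the slices that define it. -/
theorem IsSlice.apply_mul_eq {f : A →L[ℂ] ℂ} {S : T →L[ℂ] A} (hS : X.IsSlice f S) {a e d : A}
    {s t : T} (hs : (s : 𝓜(ℂ, T)) = Δ a * X.inl e) (ht : (t : 𝓜(ℂ, T)) = Δ a * X.inr d) :
    S s * d = S ((X.inl e).snd t) := by
  rw [← hS.apply_inr_snd]
  congr 1
  apply coe_multiplier_injective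
  rw [← DoubleCentralizer.coe_mul', ← DoubleCentralizer.coe_mul', hs, ht, mul_assoc, mul_assoc,
    X.inl_mul_inr, X.inr_mul_inl]

namespace IsConvolution

variable {f : A →L[ℂ] ℂ} {S : T →L[ℂ] A} {L : A →L[ℂ] A}

theorem apply_mul (h : IsConvolution X Δ S L) {a d : A} {t : T}
    (ht : (t : 𝓜(ℂ, T)) = Δ a * X.inr d) : L a * d = S t := by
  obtain ⟨t', ht', h⟩ := h a d
  rw [h, coe_multiplier_injective (ht'.trans ht.symm)]

theorem norm_le (h : X.IsConvolution Δ S L) (hS : X.IsSlice f S) (hf : IsPositiveFunctional f) :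
    ‖L‖ ≤ ‖f‖ := by
  refine ContinuousLinearMap.opNorm_le_bound _ (norm_nonneg f) fun a => ?_
  refine CStarAlgebra.norm_le_of_forall_mul (by positivity) fun d => ?_
  obtain ⟨t, ht, h⟩ := h a d
  rw [h, mul_assoc]
  exact (S.le_of_opNorm_le (hS.norm_le hf) t).trans
    (mul_le_mul_of_nonneg_left (norm_le_of_coe_eq ht) (norm_nonneg f))

/-- The slice is a bimodule map over the second leg, so d* and d' can be moved inside. Every
quadratic property of S then becomes one of L. -/
theorem star_mul_apply_mul (h : X.IsConvolution Δ S L) (hS : X.IsSlice f S) {a a' d d' : A}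
    {t t' : T} (ht : (t : 𝓜(ℂ, T)) = Δ a * X.inr d) (ht' : (t' : 𝓜(ℂ, T)) = Δ a' * X.inr d') :
    star d * L (star a * a') * d' = S (star t * t') := by
  obtain ⟨r, hr, h1⟩ := h (star a * a') d'
  rw [mul_assoc, h1, ← hS.apply_inr_fst]
  congr 1
  apply coe_multiplier_injective
  rw [← DoubleCentralizer.mul_coe, hr, ← DoubleCentralizer.coe_mul_coe,
    ← DoubleCentralizer.star_coe, ht, ht', star_mul, X.star_inr, map_mul, ← map_star]
  simp only [mul_assoc]

end IsConvolution

section Ordered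

variable [StarOrderedRing A] {f : A →L[ℂ] ℂ} {S : T →L[ℂ] A} {L : A →L[ℂ] A}

/-- The element (f ⊗ id)Δ(a) is built as the limit of the slices of Δ(a)(eₙ ⊗ 1) along almost units
eₙ of f. Tested against d, these differ from S(Δ(a)(1 ⊗ d)) by at most ‖a‖‖d‖/(n + 1), uniformly in
d, so they form a Cauchy sequence in norm. -/
theorem IsSlice.exists_isConvolution (hS : X.IsSlice f S) (hf : IsPositiveFunctional f)
    (hX : X.IsRegular Δ) : ∃ L : A →L[ℂ] A, X.IsConvolution Δ S L := by
  have hex : ∀ a, ∃ y : A, ∀ d, ∃ t : T, (t : 𝓜(ℂ, T)) = Δ a * X.inr d ∧ y * d = S t := by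
    intro a
    have hpos : ∀ n : ℕ, (0 : ℝ) < 1 / ((n : ℝ) + 1) := fun n => by positivity
    choose e he using fun n => hf.exists_isAlmostUnit (hpos n)
    choose s hs using fun n => (hX a (e n)).2
    choose t ht using fun d => (hX a d).1
    have hst : ∀ n d, ‖S (t d) - S (s n) * d‖ ≤ 1 / ((n : ℝ) + 1) * ‖a‖ * ‖d‖ := by
      intro n d
      rw [hS.apply_mul_eq (hs n) (ht d), mul_assoc]
      exact (hS.norm_sub_inl_le hf (hpos n).le (he n) _).trans
        (mul_le_mul_of_nonneg_left (norm_le_of_coe_eq (ht d)) (hpos n).le)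
    have hlim : Tendsto (fun n : ℕ => 1 / ((n : ℝ) + 1) * ‖a‖) atTop (𝓝 0) := by
      simpa using tendsto_one_div_add_atTop_nhds_zero_nat.mul_const ‖a‖
    have hc : CauchySeq fun n => S (s n) := by
      refine cauchySeq_of_le_tendsto_0 (fun n => 2 * (1 / ((n : ℝ) + 1) * ‖a‖)) ?_
        (by simpa using hlim.const_mul 2)
      intro n m N hn hm
      rw [dist_eq_norm]
      have hmono : ∀ k : ℕ, N ≤ k → 1 / ((k : ℝ) + 1) * ‖a‖ ≤ 1 / ((N : ℝ) + 1) * ‖a‖ := by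
        intro k hk
        gcongr
      refine CStarAlgebra.norm_le_of_forall_mul (by positivity) fun d => ?_
      have h1 : (S (s n) - S (s m)) * d = (S (t d) - S (s m) * d) - (S (t d) - S (s n) * d) := by
        rw [sub_mul]; abel
      rw [h1]
      refine (norm_sub_le _ _).trans ((add_le_add (hst m d) (hst n d)).trans ?_)
      have := mul_le_mul_of_nonneg_right (add_le_add (hmono m hm) (hmono n hn)) (norm_nonneg d)
      linarith
    obtain ⟨y, hy⟩ := cauchySeq_tendsto_of_complete hc
    refine ⟨y, fun d => ⟨t d, ht d, ?_⟩⟩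
    have h1 : Tendsto (fun n => S (s n) * d) atTop (𝓝 (y * d)) := hy.mul_const d
    refine tendsto_nhds_unique h1 ?_
    rw [tendsto_iff_norm_sub_tendsto_zero]
    refine squeeze_zero (fun _ => norm_nonneg _) (fun n => ?_)
      (by simpa using hlim.mul_const ‖d‖)
    rw [norm_sub_rev, ← one_div]
    exact hst n d
  choose y hy using hex
  have hy' : ∀ {a d : A} {t : T}, (t : 𝓜(ℂ, T)) = Δ a * X.inr d → y a * d = S t := by
    intro a d t ht
    obtain ⟨t', ht', h⟩ := hy a d
    rw [h, coe_multiplier_injective (ht'.trans ht.symm)]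
  refine ⟨LinearMap.mkContinuous ⟨⟨y, fun a b => ?_⟩, fun c a => ?_⟩ ‖f‖ fun a => ?_, hy⟩
  · refine CStarAlgebra.eq_of_forall_mul_right fun d => ?_
    obtain ⟨t, ht, h⟩ := hy a d
    obtain ⟨t', ht', h'⟩ := hy b d
    rw [add_mul, h, h', ← map_add]
    exact hy' (by rw [DoubleCentralizer.coe_add, ht, ht', map_add, add_mul])
  · refine CStarAlgebra.eq_of_forall_mul_right fun d => ?_
    obtain ⟨t, ht, h⟩ := hy a d
    rw [RingHom.id_apply, smul_mul_assoc, h, ← map_smul]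
    exact hy' (by rw [DoubleCentralizer.coe_smul, ht, map_smul, smul_mul_assoc])
  · refine CStarAlgebra.norm_le_of_forall_mul (by positivity) fun d => ?_
    obtain ⟨t, ht, h⟩ := hy a d
    refine (congrArg norm h).le.trans ?_
    rw [mul_assoc]
    exact (S.le_of_opNorm_le (hS.norm_le hf) t).trans
      (mul_le_mul_of_nonneg_left (norm_le_of_coe_eq ht) (norm_nonneg f))

namespace IsConvolution

theorem map_star (h : X.IsConvolution Δ S L) (hS : X.IsSlice f S) (hf : IsPositiveFunctional f)
    (a : A) : L (star a) = star (L a) := by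
  refine CStarAlgebra.eq_of_forall_mul_right fun c => CStarAlgebra.eq_of_forall_mul_left fun d => ?_
  obtain ⟨t, ht, h1⟩ := h a (star d)
  obtain ⟨r, hr, h2⟩ := h (star a) c
  have h3 : d * (star (L a) * c) = star (S t) * c := by
    rw [← h1, star_mul, star_star, mul_assoc]
  rw [h3, h2, ← hS.map_star hf, ← hS.apply_inr_snd, ← hS.apply_inr_fst]
  congr 1
  apply coe_multiplier_injective
  rw [← DoubleCentralizer.mul_coe, ← DoubleCentralizer.coe_mul', hr, ← DoubleCentralizer.star_coe,
    ht, star_mul, X.star_inr, star_star, ← StarHomClass.map_star, mul_assoc]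

/-- The Kadison-Schwarz inequality for convolution operators. -/
theorem schwarz (h : X.IsConvolution Δ S L) (hS : X.IsSlice f S) (hf : IsPositiveFunctional f)
    (a : A) : star (L a) * L a ≤ (‖f‖ : ℂ) • L (star a * a) := by
  set y := (‖f‖ : ℂ) • L (star a * a) - star (L a) * L a with hy
  -- Compressed by d, the claim is Kadison-Schwarz for S at Δ(a)(1 ⊗ d); positivity of all
  -- compressions gives positivity through an approximate unit.
  have key : ∀ d, 0 ≤ star d * y * d := by
    intro d
    obtain ⟨t, ht, h1⟩ := h a d
    have h2 := h.star_mul_apply_mul hS ht ht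
    have h3 := hS.schwarz hf t
    rw [← h1, ← h2] at h3
    have h4 : star d * y * d = (‖f‖ : ℂ) • (star d * L (star a * a) * d) -
        star (L a * d) * (L a * d) := by
      rw [hy, mul_sub, sub_mul, mul_smul_comm, smul_mul_assoc, star_mul]
      simp only [mul_assoc]
    rw [h4]
    exact sub_nonneg.2 h3
  rw [← sub_nonneg]
  exact CStarAlgebra.nonneg_of_forall_star_mul_mul key

theorem norm_sub_le (h : X.IsConvolution Δ S L) (hS : X.IsSlice f S) (hf : IsPositiveFunctional f)
    {δ : ℝ} (hδ : 0 ≤ δ) {a e : A} (he : IsAlmostUnit f δ e) {s : T}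
    (hs : (s : 𝓜(ℂ, T)) = Δ a * X.inl e) : ‖L a - S s‖ ≤ δ * ‖a‖ := by
  refine CStarAlgebra.norm_le_of_forall_mul (by positivity) fun d => ?_
  obtain ⟨t, ht, h1⟩ := h a d
  rw [sub_mul, h1, hS.apply_mul_eq hs ht, mul_assoc]
  exact (hS.norm_sub_inl_le hf hδ he t).trans
    (mul_le_mul_of_nonneg_left (norm_le_of_coe_eq ht) hδ)

end IsConvolution

end Ordered

end TensorModel

/-! ### Coassociativity -/

/-- The uniform bound allows an approximation argument. It reduces a limit over the whole tensor
product to one over elementary tensors. -/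
theorem ContinuousLinearMap.isClosed_setOf_tendsto {E F : Type*} [NormedAddCommGroup E]
    [NormedSpace ℂ E] [NormedAddCommGroup F] [NormedSpace ℂ F] {K : ℕ → E →L[ℂ] F} {K₀ : E →L[ℂ] F}
    {C : ℝ} (hK : ∀ n, ‖K n‖ ≤ C) :
    IsClosed {x | Tendsto (fun n => K n x) atTop (𝓝 (K₀ x))} := by
  refine isClosed_of_closure_subset fun x hx => ?_
  rw [Set.mem_ofPred_eq, Metric.tendsto_atTop]
  intro ε hε
  have hC : 0 ≤ C := (norm_nonneg _).trans (hK 0)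
  obtain ⟨y, hy, hxy⟩ := Metric.mem_closure_iff.1 hx (ε / (2 * (C + ‖K₀‖ + 1))) (by positivity)
  obtain ⟨N, hN⟩ := Metric.tendsto_atTop.1 hy (ε / 2) (by positivity)
  refine ⟨N, fun n hn => ?_⟩
  have h1 : K n x - K₀ x = K n (x - y) + (K n y - K₀ y) - K₀ (x - y) := by
    simp only [map_sub]; abel
  have h2 := hN n hn
  rw [dist_eq_norm] at h2 hxy ⊢
  rw [h1]
  have h3 := (K n).le_of_opNorm_le (hK n) (x - y)
  have h4 := K₀.le_opNorm (x - y)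
  have h5 : (C + ‖K₀‖) * ‖x - y‖ ≤ ε / 2 := by
    have h6 : (C + ‖K₀‖ + 1) * ‖x - y‖ ≤ (C + ‖K₀‖ + 1) * (ε / (2 * (C + ‖K₀‖ + 1))) := by
      gcongr
    have h7 : (C + ‖K₀‖ + 1) * (ε / (2 * (C + ‖K₀‖ + 1))) = ε / 2 := by
      field_simp
    nlinarith [norm_nonneg (x - y)]
  calc _ ≤ ‖K n (x - y)‖ + ‖K n y - K₀ y‖ + ‖K₀ (x - y)‖ :=
        (norm_sub_le _ _).trans (by gcongr; exact norm_add_le _ _)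
    _ < ε := by linarith

theorem DoubleCentralizer.continuous_fst_apply {E : Type*} [NonUnitalCStarAlgebra E] (y : E) :
    Continuous fun m : 𝓜(ℂ, E) => m.fst y := by
  refine AddMonoidHomClass.continuous_of_bound
    (⟨⟨fun m : 𝓜(ℂ, E) => m.fst y, by simp⟩, fun m m' => by simp⟩ : 𝓜(ℂ, E) →+ E) ‖y‖ fun m => ?_
  rw [← DoubleCentralizer.norm_fst, mul_comm]
  exact m.fst.le_opNorm _

namespace TensorModel

section TmulL

variable {A B T : Type*} [NonUnitalCStarAlgebra A] [PartialOrder A] [NonUnitalCStarAlgebra B]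
  [NonUnitalCStarAlgebra T] (X : TensorModel A B T)

/-- The elementary tensors as a continuous bilinear map. -/
def tmulL : A →L[ℂ] B →L[ℂ] T :=
  X.tmul.mkContinuous₂ 1 fun a b => by simpa using X.norm_tmul_le a b

@[simp]
theorem tmulL_apply (a : A) (b : B) : X.tmulL a b = X.tmul a b := rfl

end TmulL

theorem IsSlice.fst_tmul {A T : Type*} [NonUnitalCStarAlgebra A] [PartialOrder A]
    [NonUnitalCStarAlgebra T] {X : TensorModel A A T} {Δ : A →⋆ₙₐ[ℂ] 𝓜(ℂ, T)} {f : A →L[ℂ] ℂ}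
    {S : T →L[ℂ] A} (hS : X.IsSlice f S) {a u : A} {s : T}
    (hs : (s : 𝓜(ℂ, T)) = Δ a * X.inl u) (v : A) :
    S ((Δ a).fst (X.tmul u v)) = S s * v := by
  rw [← hS.apply_inr_snd]
  congr 1
  apply coe_multiplier_injective
  rw [← DoubleCentralizer.mul_coe, ← DoubleCentralizer.coe_mul', hs, ← X.inl_mul_inr, mul_assoc]

section TensorHomLeft

variable {A T U : Type*} [NonUnitalCStarAlgebra A] [PartialOrder A] [StarOrderedRing A]
  [NonUnitalCStarAlgebra T] [NonUnitalCStarAlgebra U]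
  {X : TensorModel A A T} {Y : TensorModel A T U}
  {Δ : A →⋆ₙₐ[ℂ] 𝓜(ℂ, T)} {f : A →L[ℂ] ℂ} {S : T →L[ℂ] A}

/-- Only the values of Ψ on the tensor product itself are prescribed. They determine Ψ(a ⊗ 1) on
vectors pc ⊗ Δ(q)y; nondegeneracy of Δ makes the second legs dense, and an approximate unit reaches
every first leg. -/
theorem tensorHom_inl_fst (hΔ : IsNondegenerate Δ) {Ψ : 𝓜(ℂ, T) →⋆ₐ[ℂ] 𝓜(ℂ, U)}
    (hΨ : ∀ a b c d, (Ψ (X.tmul a b : T)).fst (Y.tmul c d) = Y.tmul (a * c) ((Δ b).fst d))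
    (a c : A) (y : T) : (Ψ (X.inl a)).fst (Y.tmul c y) = Y.tmul (a * c) y := by
  have h1 : ∀ p q c' y', (Ψ (X.inl a)).fst (Y.tmul (p * c') ((Δ q).fst y')) =
      Y.tmul (a * (p * c')) ((Δ q).fst y') := by
    intro p q c' y'
    rw [← hΨ, ← mul_assoc, ← hΨ, ← X.inl_fst, ← DoubleCentralizer.mul_coe, map_mul,
      DoubleCentralizer.mul_fst]
    rfl
  have h2 : ∀ p c' y, (Ψ (X.inl a)).fst (Y.tmul (p * c') y) = Y.tmul (a * (p * c')) y := by
    intro p c'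
    have : (Ψ (X.inl a)).fst ∘L Y.tmulL (p * c') = Y.tmulL (a * (p * c')) := by
      refine ContinuousLinearMap.ext_on (s := {x : T | ∃ a b, x = (Δ a).fst b}) ?_ ?_
      · exact Submodule.dense_iff_topologicalClosure_eq_top.2 hΔ
      · rintro _ ⟨q, y', rfl⟩
        simpa using h1 p q c' y'
    exact fun w => congrArg (fun F : T →L[ℂ] U => F w) this
  have hl := (CStarAlgebra.increasingApproximateUnit A).tendsto_mul_right c
  have h3 : Continuous fun x : A => (Ψ (X.inl a)).fst (Y.tmulL x y) := by fun_prop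
  have h4 : Continuous fun x : A => Y.tmulL (a * x) y := by fun_prop
  refine tendsto_nhds_unique ((h3.tendsto c).comp hl) ?_
  exact ((h4.tendsto c).comp hl).congr fun e => (h2 e c y).symm

/-- This is (f ⊗ id)(id ⊗ Δ) = Δ ∘ (f ⊗ id), localized by u so that every slice is taken of an
element of a tensor product. -/
theorem IsSlice.tensorHom_fst_tmul (hS : X.IsSlice f S) {SY : U →L[ℂ] T} (hSY : Y.IsSlice f SY)
    (hΔ : IsNondegenerate Δ) {Ψ : 𝓜(ℂ, T) →⋆ₐ[ℂ] 𝓜(ℂ, U)}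
    (hΨ : ∀ a b c d, (Ψ (X.tmul a b : T)).fst (Y.tmul c d) = Y.tmul (a * c) ((Δ b).fst d))
    (hX : X.IsRegular Δ) {a u : A} (hu : 0 ≤ u) {s : T}
    (hs : (s : 𝓜(ℂ, T)) = Δ a * X.inl u) (y : T) :
    SY ((Ψ (Δ a)).fst (Y.tmul u y)) = (Δ (S s)).fst y := by
  have key : ∀ (c : A) (r : T), SY ((Ψ (r : T)).fst (Y.tmul c y)) =
      (Δ (S ((X.inl c).snd r))).fst y := by
    intro c r
    have hc1 : Continuous fun r : T => (Ψ (r : T)).fst (Y.tmul c y) :=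
      (DoubleCentralizer.continuous_fst_apply _).comp ((AddMonoidHomClass.continuous_of_bound Ψ 1
        (by simpa using NonUnitalStarAlgHom.norm_apply_le Ψ)).comp
          DoubleCentralizer.isometry_coe.continuous)
    have hc2 : Continuous fun r : T => (Δ (S ((X.inl c).snd r))).fst y :=
      (DoubleCentralizer.continuous_fst_apply _).comp ((AddMonoidHomClass.continuous_of_bound Δ 1
        (by simpa using NonUnitalStarAlgHom.norm_apply_le Δ)).comp (by fun_prop))
    refine X.induction (p := fun r => SY ((Ψ (r : T)).fst (Y.tmul c y)) =
      (Δ (S ((X.inl c).snd r))).fst y) (isClosed_eq (SY.continuous.comp hc1) hc2)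
      (fun p q => ?_) (fun r r' hr hr' => ?_) r
    · rw [hΨ, hSY, X.inl_snd, hS, map_smul]
      rfl
    · rw [DoubleCentralizer.coe_add, map_add, map_add, map_add, map_add,
        DoubleCentralizer.add_fst, DoubleCentralizer.add_fst, add_apply,
        add_apply, map_add, hr, hr']
  -- Splitting u = x*x uses one factor to bring Δ(a)(x* ⊗ 1) into the tensor product, where Ψ is
  -- known by continuity, and leaves x as a vector in the first leg.
  obtain ⟨x, rfl⟩ := CStarAlgebra.nonneg_iff_eq_star_mul_self.1 hu
  obtain ⟨r, hr⟩ := (hX a (star x)).2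
  have h1 : (Ψ (Δ a)).fst (Y.tmul (star x * x) y) = (Ψ (r : T)).fst (Y.tmul x y) := by
    rw [← tensorHom_inl_fst hΔ hΨ, hr, map_mul, DoubleCentralizer.mul_fst]
    rfl
  rw [h1, key]
  congr 5
  apply coe_multiplier_injective
  rw [← DoubleCentralizer.coe_mul', hr, hs, X.inl_mul, mul_assoc]

end TensorHomLeft

section TensorHom

variable {A T V : Type*} [NonUnitalCStarAlgebra A] [PartialOrder A] [StarOrderedRing A]
  [NonUnitalCStarAlgebra T] [PartialOrder T] [NonUnitalCStarAlgebra V]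
  {X : TensorModel A A T} {Z : TensorModel T A V}
  {Δ : A →⋆ₙₐ[ℂ] 𝓜(ℂ, T)}

theorem tensorHom_inr_fst (hΔ : IsNondegenerate Δ) {Φ : 𝓜(ℂ, T) →⋆ₐ[ℂ] 𝓜(ℂ, V)}
    (hΦ : ∀ a b c d, (Φ (X.tmul a b : T)).fst (Z.tmul c d) = Z.tmul ((Δ a).fst c) (b * d))
    (b : A) (w : T) (d : A) : (Φ (X.inr b)).fst (Z.tmul w d) = Z.tmul w (b * d) := by
  have h1 : ∀ p q w' d', (Φ (X.inr b)).fst (Z.tmul ((Δ p).fst w') (q * d')) =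
      Z.tmul ((Δ p).fst w') (b * (q * d')) := by
    intro p q w' d'
    rw [← hΦ, ← mul_assoc, ← hΦ, ← X.inr_fst, ← DoubleCentralizer.mul_coe, map_mul,
      DoubleCentralizer.mul_fst]
    rfl
  have h2 : ∀ q d' w, (Φ (X.inr b)).fst (Z.tmul w (q * d')) = Z.tmul w (b * (q * d')) := by
    intro q d'
    have : (Φ (X.inr b)).fst ∘L Z.tmulL.flip (q * d') = Z.tmulL.flip (b * (q * d')) := by
      refine ContinuousLinearMap.ext_on (s := {x : T | ∃ a b, x = (Δ a).fst b}) ?_ ?_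
      · exact Submodule.dense_iff_topologicalClosure_eq_top.2 hΔ
      · rintro _ ⟨p, w', rfl⟩
        simpa using h1 p q w' d'
    exact fun w => congrArg (fun F : T →L[ℂ] V => F w) this
  have hl := (CStarAlgebra.increasingApproximateUnit A).tendsto_mul_right d
  have h3 : Continuous fun x : A => (Φ (X.inr b)).fst (Z.tmulL w x) := by fun_prop
  have h4 : Continuous fun x : A => Z.tmulL w (b * x) := by fun_prop
  refine tendsto_nhds_unique ((h3.tendsto d).comp hl) ?_
  exact ((h4.tendsto d).comp hl).congr fun e => (h2 e d w).symm

end TensorHom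

section Idempotent

variable {A T U V : Type*} [NonUnitalCStarAlgebra A] [PartialOrder A] [StarOrderedRing A]
  [NonUnitalCStarAlgebra T] [PartialOrder T] [StarOrderedRing T] [NonUnitalCStarAlgebra U]
  [NonUnitalCStarAlgebra V]
  {X : TensorModel A A T} {Y : TensorModel A T U} {Z : TensorModel T A V}
  {Δ : A →⋆ₙₐ[ℂ] 𝓜(ℂ, T)} {f : A →L[ℂ] ℂ} {S : T →L[ℂ] A} {L : A →L[ℂ] A}

theorem IsSlice.map_nonneg (hS : X.IsSlice f S) (hf : IsPositiveFunctional f) {t : T}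
    (ht : 0 ≤ t) : 0 ≤ S t := by
  obtain ⟨s, rfl⟩ := CStarAlgebra.nonneg_iff_eq_star_mul_self.1 ht
  -- The constant ‖f‖ + 1 replaces ‖f‖ so that it can be divided out even when f = 0.
  have h := hS.dominated hf hS (K := ‖f‖ + 1) (fun a => (hf.norm_apply_sq_le a).trans
    (mul_le_mul_of_nonneg_right (by linarith) (hf.re_nonneg a))) s
  have h1 := (star_mul_self_nonneg (S s)).trans h
  have h2 : 0 < ‖f‖ + 1 := by positivity
  rw [Complex.coe_smul] at h1
  have h3 := smul_nonneg (inv_nonneg.2 h2.le) h1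
  rwa [inv_smul_smul₀ h2.ne'] at h3

/-- Put t = Δ(a)(1 ⊗ d) and evaluate the limit of (f ⊗ f ⊗ id)((Δ ⊗ id)(t)(eₙ ⊗ eₙ ⊗ d')) in two
ways. Coassociativity rewrites it as two successive convolutions, with limit L(L(a))dd'. For t = p ⊗
q the limit is f(L(p))qd' = f(p)qd', so in general it is S(t)d', here L(a)dd'. -/
theorem IsConvolution.comp_self (h : X.IsConvolution Δ S L) (hS : X.IsSlice f S)
    (hf : IsPositiveFunctional f) (hΔ : IsNondegenerate Δ) (hX : X.IsRegular Δ)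
    {Φ : 𝓜(ℂ, T) →⋆ₐ[ℂ] 𝓜(ℂ, V)} {Ψ : 𝓜(ℂ, T) →⋆ₐ[ℂ] 𝓜(ℂ, U)} {α : V →⋆ₙₐ[ℂ] U}
    (hα : ∀ a b c, α (Z.tmul (X.tmul a b) c) = Y.tmul a (X.tmul b c))
    (hΦ : ∀ a b c d, (Φ (X.tmul a b : T)).fst (Z.tmul c d) = Z.tmul ((Δ a).fst c) (b * d))
    (hΨ : ∀ a b c d, (Ψ (X.tmul a b : T)).fst (Y.tmul c d) = Y.tmul (a * c) ((Δ b).fst d))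
    (hco : ∀ a x, α ((Φ (Δ a)).fst x) = (Ψ (Δ a)).fst (α x)) (hfL : ∀ a, f (L a) = f a) (a : A) :
    L (L a) = L a := by
  obtain ⟨SY, hSY, -⟩ := Y.exists_isSlice hf
  -- This functional is f ⊗ f on A ⊗ A, so `SZ` below is f ⊗ f ⊗ id.
  have hf2 : IsPositiveFunctional (f ∘L S) := fun t ht => hf _ (hS.map_nonneg hf ht)
  obtain ⟨SZ, hSZ, -⟩ := Z.exists_isSlice hf2
  have hSα : ∀ v, SZ v = S (SY (α v)) := by
    have hαc : Continuous α := AddMonoidHomClass.continuous_of_bound α 1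
      (by simpa using NonUnitalStarAlgHom.norm_apply_le α)
    refine Z.induction (isClosed_eq SZ.continuous (S.continuous.comp (SY.continuous.comp hαc)))
      (fun t c => ?_) (fun v w hv hw => by simp only [map_add, hv, hw])
    refine X.induction (p := fun t => SZ (Z.tmul t c) = S (SY (α (Z.tmul t c))))
      (isClosed_eq (SZ.continuous.comp (Z.tmulL.flip c).continuous)
        (S.continuous.comp (SY.continuous.comp (hαc.comp (Z.tmulL.flip c).continuous))))
      (fun p q => ?_) (fun v w hv hw => ?_) t
    · rw [hα, hSZ, hSY, map_smul, hS, ContinuousLinearMap.comp_apply, hS, map_smul, smul_smul,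
        smul_eq_mul]
    · simp only [map_add, LinearMap.add_apply] at hv hw ⊢
      rw [hv, hw]
  have hpos : ∀ n : ℕ, (0 : ℝ) < 1 / ((n : ℝ) + 1) := fun n => by positivity
  choose e he using fun n => hf.exists_isAlmostUnit (hpos n)
  have hlim := tendsto_one_div_add_atTop_nhds_zero_nat (𝕜 := ℝ)
  have hmul : ∀ (x : ℕ → A) (y : A), Tendsto x atTop (𝓝 y) →
      Tendsto (fun n => f (x n * e n)) atTop (𝓝 (f y)) := by
    intro x y hxy
    have h1 : Tendsto (fun n => f (x n)) atTop (𝓝 (f y)) := (f.continuous.tendsto y).comp hxy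
    have h2 : Tendsto (fun n => f (x n) - f (x n * e n)) atTop (𝓝 0) := by
      refine squeeze_zero_norm (fun n => (he n).norm_sub_le hf (hpos n).le (x n)) ?_
      simpa using hlim.mul hxy.norm
    simpa using h1.sub h2
  -- The argument x may vary with n because in the nested slice the inner result depends on the same
  -- eₙ as the outer one.
  have hslice : ∀ (x : ℕ → A) (y : A) (s : ℕ → T), Tendsto x atTop (𝓝 y) →
      (∀ n, (s n : 𝓜(ℂ, T)) = Δ (x n) * X.inl (e n)) →
      Tendsto (fun n => S (s n)) atTop (𝓝 (L y)) := by
    intro x y s hxy hs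
    have h1 : Tendsto (fun n => L (x n)) atTop (𝓝 (L y)) := (L.continuous.tendsto y).comp hxy
    have h2 : Tendsto (fun n => L (x n) - S (s n)) atTop (𝓝 0) := by
      refine squeeze_zero_norm (fun n => h.norm_sub_le hS hf (hpos n).le (he n) (hs n)) ?_
      simpa using hlim.mul hxy.norm
    simpa using h1.sub h2
  choose s hs using fun a u => (hX a u).2
  refine CStarAlgebra.eq_of_forall_mul_right fun d =>
    CStarAlgebra.eq_of_forall_mul_right fun d' => ?_
  obtain ⟨t, ht, h1⟩ := h a d
  -- Since ‖eₙ‖ ≤ 1, these maps are bounded uniformly in n, which is what permits checking the limit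
  -- on elementary tensors.
  let K : ℕ → T →L[ℂ] A := fun n => LinearMap.mkContinuous
    ⟨⟨fun r => SZ ((Φ (r : T)).fst (Z.tmul (X.tmul (e n) (e n)) d')), fun r r' => by
      simp [DoubleCentralizer.coe_add]⟩, fun c r => by simp [DoubleCentralizer.coe_smul]⟩
    (‖SZ‖ * ‖d'‖) fun r => by
      have h1 : ‖Z.tmul (X.tmul (e n) (e n)) d'‖ ≤ 1 * 1 * ‖d'‖ :=
        (Z.norm_tmul_le _ _).trans (mul_le_mul_of_nonneg_right ((X.norm_tmul_le _ _).trans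
          (mul_le_mul (he n).2.1 (he n).2.1 (norm_nonneg _) zero_le_one)) (norm_nonneg _))
      have h2 : ‖(Φ (r : T)).fst‖ ≤ ‖r‖ := by
        rw [DoubleCentralizer.norm_fst, ← DoubleCentralizer.norm_coe r]
        exact NonUnitalStarAlgHom.norm_apply_le Φ _
      refine (SZ.le_opNorm _).trans ?_
      rw [mul_assoc]
      refine mul_le_mul_of_nonneg_left ?_ (norm_nonneg _)
      refine ((Φ (r : T)).fst.le_of_opNorm_le h2 _).trans ?_
      rw [mul_comm]
      exact mul_le_mul_of_nonneg_right (by simpa using h1) (norm_nonneg _)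
  have hKr : ∀ n r, K n r = SZ ((Φ (r : T)).fst (Z.tmul (X.tmul (e n) (e n)) d')) :=
    fun n r => rfl
  have hK : ∀ r, Tendsto (fun n => K n r) atTop (𝓝 (S r * d')) := by
    refine X.induction (ContinuousLinearMap.isClosed_setOf_tendsto
      (K₀ := (ContinuousLinearMap.mul ℂ A).flip d' ∘L S) (C := ‖SZ‖ * ‖d'‖)
      fun n => LinearMap.mkContinuous_norm_le _ (by positivity) _) (fun p q => ?_)
      (fun r r' hr hr' => ?_)
    · have h2 : ∀ n, K n (X.tmul p q) = f (S (s p (e n)) * e n) • (q * d') := by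
        intro n
        rw [hKr, hΦ, hSZ, ContinuousLinearMap.comp_apply, hS.fst_tmul (hs p (e n))]
      simp_rw [h2]
      rw [hS, smul_mul_assoc, ← hfL p]
      exact (hmul _ _ (hslice _ _ _ tendsto_const_nhds fun n => hs p (e n))).smul_const _
    · simp only [map_add, add_mul]
      exact hr.add hr'
  have hK' : Tendsto (fun n => K n t) atTop (𝓝 (L (L a) * d * d')) := by
    have h2 : ∀ n, K n t = S (s (S (s a (e n))) (e n)) * (d * d') := by
      intro n
      rw [hKr, ht, map_mul, DoubleCentralizer.mul_fst,
        ContinuousLinearMap.mul_def, ContinuousLinearMap.comp_apply,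
        tensorHom_inr_fst hΔ hΦ, hSα, hco, hα,
        hS.tensorHom_fst_tmul hSY hΔ hΨ hX (he n).1 (hs a (e n)), hS.fst_tmul (hs _ _)]
    simp_rw [h2, mul_assoc]
    exact (hslice _ _ _ (hslice _ _ _ tendsto_const_nhds fun n => hs a (e n))
      fun n => hs _ (e n)).mul_const _
  rw [tendsto_nhds_unique hK' (hK t), h1]

end Idempotent

end TensorModel

/-! ### Conditional expectations -/

namespace CStarWeight

variable {A : Type*} [NonUnitalCStarAlgebra A] [PartialOrder A] [StarOrderedRing A]

theorem mono (φ : CStarWeight A) {a b : A} (ha : 0 ≤ a) (hab : a ≤ b) : φ a ≤ φ b := by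
  have h := φ.map_add a (b - a) ha (sub_nonneg.2 hab)
  rw [add_sub_cancel] at h
  rw [h]
  exact le_self_add

/-- The elements `b` with `φ(b* b) < ∞`. -/
def squareIntegrable (φ : CStarWeight A) : Submodule ℂ A where
  carrier := {b | φ (star b * b) < ∞}
  zero_mem' := by
    have := φ.map_smul 0 0 le_rfl le_rfl
    simp_all
  add_mem' := by
    intro a b ha hb
    have h1 : star (a + b) * (a + b) ≤ (2 : ℝ) • (star a * a + star b * b) := by
      have h2 := star_mul_self_nonneg (a - b)
      rw [← sub_nonneg]
      convert h2 using 1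
      rw [two_smul]
      simp only [star_add, star_sub, add_mul, mul_add, sub_mul, mul_sub]
      abel
    refine (φ.mono (star_mul_self_nonneg _) h1).trans_lt ?_
    rw [φ.map_smul _ _ zero_le_two (add_nonneg (star_mul_self_nonneg _) (star_mul_self_nonneg _)),
      φ.map_add _ _ (star_mul_self_nonneg _) (star_mul_self_nonneg _)]
    exact ENNReal.mul_lt_top ENNReal.ofReal_lt_top (ENNReal.add_lt_top.2 ⟨ha, hb⟩)
  smul_mem' := by
    intro c b hb
    have h1 : star (c • b) * (c • b) = (‖c‖ ^ 2 : ℝ) • (star b * b) := by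
      rw [star_smul, smul_mul_smul_comm, ← Complex.coe_smul, Complex.star_def,
        ← Complex.normSq_eq_conj_mul_self, Complex.normSq_eq_norm_sq]
    change φ (star (c • b) * (c • b)) < ∞
    rw [h1, φ.map_smul _ _ (sq_nonneg _) (star_mul_self_nonneg _)]
    exact ENNReal.mul_lt_top ENNReal.ofReal_lt_top hb

/-- A positive a of finite weight is square integrable because a² ≤ ‖a‖a. Such elements are dense in
the positive cone, which spans the algebra. -/
theorem IsDenselyDefined.dense_squareIntegrable {φ : CStarWeight A} (hφ : φ.IsDenselyDefined) :
    Dense (φ.squareIntegrable : Set A) := by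
  rw [Submodule.dense_iff_topologicalClosure_eq_top, eq_top_iff, ← CStarAlgebra.span_nonneg,
    Submodule.span_le]
  refine hφ.trans (closure_mono ?_)
  rintro a ⟨ha, hfin⟩
  have h2 : star a * a ≤ ‖a‖ • a := by
    obtain ⟨s, hs, rfl⟩ : ∃ s, star s = s ∧ s * s = a :=
      ⟨CFC.sqrt a, (IsSelfAdjoint.of_nonneg (CFC.sqrt_nonneg a)).star_eq,
        CFC.sqrt_mul_sqrt_self a ha⟩
    have h1 := CStarAlgebra.star_left_conjugate_le_norm_smul (a := s) (b := s * s)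
    rw [hs] at h1
    rw [star_mul, hs]
    simpa only [mul_assoc] using h1
  change φ (star a * a) < ∞
  refine (φ.mono (star_mul_self_nonneg a) h2).trans_lt ?_
  rw [φ.map_smul _ _ (norm_nonneg a) ha]
  exact ENNReal.mul_lt_top ENNReal.ofReal_lt_top hfin

end CStarWeight

section ConditionalExpectation

variable {A : Type*} [NonUnitalCStarAlgebra A] [PartialOrder A] [StarOrderedRing A]

/-- An idempotent map that satisfies the Kadison-Schwarz inequality and preserves a faithful weight
is multiplicative on its range. -/
theorem map_star_mul_of_schwarz_of_weight {E : A →L[ℂ] A} (hid : ∀ a, E (E a) = E a)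
    (hsch : ∀ a, star (E a) * E a ≤ E (star a * a)) {φ : CStarWeight A}
    (hdense : φ.IsDenselyDefined) (hfaith : φ.IsFaithful)
    (hinv : ∀ a, 0 ≤ a → φ a < ∞ → φ (E a) = φ a) (a b : A) :
    E (star (E a) * E b) = star (E a) * E b := by
  have h1 : ∀ a, E (star (E a) * E a) = star (E a) * E a := by
    intro a
    refine hdense.dense_squareIntegrable.induction (P := fun a =>
      E (star (E a) * E a) = star (E a) * E a) (fun a ha => ?_)
      (isClosed_eq (by fun_prop) (by fun_prop)) a
    have h0 := star_mul_self_nonneg (E a)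
    -- Finiteness is needed in order to cancel this weight below; it follows from the Schwarz
    -- inequality and invariance at a*a.
    have hfin : φ (star (E a) * E a) < ∞ := by
      have ha' : φ (star a * a) < ∞ := ha
      refine (φ.mono h0 (hsch a)).trans_lt ?_
      rwa [hinv _ (star_mul_self_nonneg a) ha']
    have h2 : star (E a) * E a ≤ E (star (E a) * E a) := by
      simpa only [hid] using hsch (E a)
    have h3 := φ.map_add _ _ h0 (sub_nonneg.2 h2)
    rw [add_sub_cancel, hinv _ h0 hfin] at h3
    -- The positive element E(x) - x with x = E(a)*E(a) has weight zero, as φ(E(x)) = φ(x) < ∞;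
    -- faithfulness finishes.
    have h4 : φ (E (star (E a) * E a) - star (E a) * E a) = 0 :=
      (ENNReal.add_right_inj hfin.ne).1 (by rw [← h3, add_zero])
    exact sub_eq_zero.1 (hfaith _ (sub_nonneg.2 h2) h4)
  -- Polarization applies because the range of E is a linear subspace, so the case of equal
  -- arguments covers each of the four squares.
  have hpol : ∀ x y : A, star x * y = (4 : ℂ)⁻¹ • (star (x + y) * (x + y) -
      star (x - y) * (x - y) - Complex.I • (star (x + Complex.I • y) * (x + Complex.I • y)) +
      Complex.I • (star (x - Complex.I • y) * (x - Complex.I • y))) := by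
    intro x y
    simp only [star_add, star_sub, star_smul, add_mul, mul_add, sub_mul, mul_sub, smul_mul_assoc,
      mul_smul_comm, smul_add, smul_sub, smul_smul, Complex.star_def, Complex.conj_I]
    have hI : Complex.I * Complex.I = -1 := Complex.I_mul_I
    simp only [mul_neg, neg_smul, hI, neg_neg]
    module
  have hlin : ∀ c d : ℂ, E (star (c • E a + d • E b) * (c • E a + d • E b)) =
      star (c • E a + d • E b) * (c • E a + d • E b) := by
    intro c d
    simpa only [map_add, map_smul] using h1 (c • a + d • b)
  have e1 := hlin 1 1
  have e2 := hlin 1 (-1)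
  have e3 := hlin 1 Complex.I
  have e4 := hlin 1 (-Complex.I)
  simp only [one_smul, neg_smul, ← sub_eq_add_neg] at e1 e2 e3 e4
  rw [hpol (E a) (E b)]
  simp only [map_smul, map_add, map_sub] at e1 e2 e3 e4 ⊢
  rw [e1, e2, e3, e4]

theorem isConditionalExpectation_of_idempotent {A : Type*} [NonUnitalCStarAlgebra A] {E : A →L[ℂ] A}
    (hE : ‖E‖ ≤ 1) (hE0 : E ≠ 0)
    (hstar : ∀ a, E (star a) = star (E a)) (hid : ∀ a, E (E a) = E a)
    (hmul : ∀ a b, E (star (E a) * E b) = star (E a) * E b) : IsConditionalExpectation E := by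
  refine ⟨le_antisymm hE ?_, ?_⟩
  · have h1 : 0 < ‖E‖ := norm_pos_iff.2 hE0
    have h2 : ‖E‖ ≤ ‖E‖ * ‖E‖ := by
      have : E ∘L E = E := ContinuousLinearMap.ext hid
      calc ‖E‖ = ‖E ∘L E‖ := by rw [this]
        _ ≤ _ := E.opNorm_comp_le E
    nlinarith
  · refine ⟨{ LinearMap.range E.toLinearMap with
      mul_mem' := ?_
      star_mem' := ?_ }, ?_, fun a => ⟨a, rfl⟩, ?_⟩
    · rintro _ _ ⟨a, rfl⟩ ⟨b, rfl⟩
      refine ⟨E a * E b, ?_⟩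
      have := hmul (star a) b
      rwa [hstar, star_star] at this
    · rintro _ ⟨a, rfl⟩
      exact ⟨star a, hstar a⟩
    · have : {x | E x = x} = (Set.range E) := by
        ext x
        exact ⟨fun h => ⟨x, h⟩, by rintro ⟨a, rfl⟩; exact hid a⟩
      change IsClosed (Set.range E)
      rw [← this]
      exact isClosed_eq E.continuous continuous_id
    · rintro _ ⟨a, rfl⟩
      exact hid a

/-- A character commutes with functional calculus. Applying s ↦ min(|s|/t, 1) with t = |ε(c)|² to
c*c therefore gives value exactly 1 under ε; the function vanishes at 0, so the result stays in C.
-/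
theorem NonUnitalStarSubalgebra.exists_apply_eq_one (ε : A →⋆ₙₐ[ℂ] ℂ)
    (C : NonUnitalStarSubalgebra ℂ A) (hC : IsClosed (C : Set A)) {c : A} (hc : c ∈ C)
    (hεc : ε c ≠ 0) : ∃ u ∈ C, 0 ≤ u ∧ ‖u‖ ≤ 1 ∧ ε u = 1 := by
  set x := star c * c with hx
  set t := ‖ε c‖ ^ 2 with ht
  have ht0 : 0 < t := by positivity
  have hεx : ε x = ((t : ℝ) : ℂ) := by
    rw [hx, map_mul, map_star, Complex.star_def, ← Complex.normSq_eq_conj_mul_self,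
      Complex.normSq_eq_norm_sq]
  have hx0 : 0 ≤ x := star_mul_self_nonneg c
  let g : ℝ → ℝ := fun s => min (|s| / t) 1
  have hg0 : g 0 = 0 := by simp [g]
  have hgc : Continuous g := by fun_prop
  have hgn : ∀ s, 0 ≤ g s := fun s => le_min (by positivity) zero_le_one
  refine ⟨cfcₙ g x, cfcₙ_mem (hs := hC) g (mul_mem (star_mem hc) hc), cfcₙ_nonneg fun s _ => hgn s,
    norm_cfcₙ_le fun s _ => ?_, ?_⟩
  · rw [Real.norm_of_nonneg (hgn s)]
    exact min_le_right _ _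
  · have hcont : Continuous ε := AddMonoidHomClass.continuous_of_bound ε 1
      (by simpa using NonUnitalStarAlgHom.norm_apply_le ε)
    rw [NonUnitalStarAlgHom.map_cfcₙ ε g x hgc.continuousOn hg0 hcont
      (IsSelfAdjoint.of_nonneg hx0) ((IsSelfAdjoint.of_nonneg hx0).map ε), hεx,
      cfcₙ_eq_cfc hgc.continuousOn hg0]
    have : ((t : ℝ) : ℂ) = algebraMap ℝ ℂ t := rfl
    rw [this, cfc_algebraMap]
    simp [g, abs_of_pos ht0, ht0.ne']

/-- On the range C of E the functional ω coincides with the character ε, and ε is not zero there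
since ω ≠ 0. The element u ∈ C with ε(u) = 1 thus also has ω(u) = 1. -/
theorem IsConditionalExpectation.isState {E : A →L[ℂ] A} (hE : IsConditionalExpectation E)
    (ε : A →⋆ₙₐ[ℂ] ℂ) {ω : A →L[ℂ] ℂ} (hω : ∀ a, ω a = ε (E a)) (hne : ω ≠ 0) : IsState ω := by
  obtain ⟨hE1, C, hC, hEC, hfix⟩ := hE
  have hn : ‖ω‖ ≤ 1 := ω.opNorm_le_bound zero_le_one fun a => by
    rw [hω]
    refine (NonUnitalStarAlgHom.norm_apply_le ε _).trans ?_
    rw [← hE1]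
    exact E.le_opNorm a
  obtain ⟨a, ha⟩ : ∃ a, ω a ≠ 0 := by
    by_contra! h
    exact hne (ContinuousLinearMap.ext h)
  obtain ⟨u, hu, hu0, hu1, hεu⟩ := C.exists_apply_eq_one ε hC (hEC a) (by rwa [← hω])
  have hωu : ω u = 1 := by rw [hω, hfix u hu, hεu]
  refine ⟨isPositiveFunctional_of_apply_eq_one ω hn hu0 hu1 hωu, le_antisymm hn ?_⟩
  have := ω.le_of_opNorm_le_of_le le_rfl hu1
  simpa [hωu] using this

theorem IsConditionalExpectation.idempotent {A : Type*} [NonUnitalCStarAlgebra A] {E : A →L[ℂ] A}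
    (hE : IsConditionalExpectation E) (a : A) : E (E a) = E a := by
  obtain ⟨-, C, -, hEC, hfix⟩ := hE
  exact hfix _ (hEC a)

end ConditionalExpectation

/-! ### The Fubini identity and the bounded counit -/

namespace TensorModel

variable {A T : Type*} [NonUnitalCStarAlgebra A] [PartialOrder A] [StarOrderedRing A]
  [NonUnitalCStarAlgebra T] {X X' : TensorModel A A T} {Δ : A →⋆ₙₐ[ℂ] 𝓜(ℂ, T)}

/-- The Fubini theorem `(f ⊗ g)Δ = g ∘ (f ⊗ id)Δ = f ∘ (id ⊗ g)Δ`. -/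
theorem IsConvolution.apply_eq {f g : A →L[ℂ] ℂ} {S S' : T →L[ℂ] A} {L R : A →L[ℂ] A}
    (h : X.IsConvolution Δ S L) (hS : X.IsSlice f S) (hf : IsPositiveFunctional f)
    (h' : X'.IsConvolution Δ S' R) (hS' : X'.IsSlice g S')
    (htmul : ∀ a b, X'.tmul b a = X.tmul a b) (hinr : X'.inr = X.inl) (a : A) :
    g (L a) = f (R a) := by
  have hSS : ∀ t, g (S t) = f (S' t) := by
    intro t
    refine X.induction (p := fun t => g (S t) = f (S' t)) (isClosed_eq (by fun_prop) (by fun_prop))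
      (fun a b => ?_) (fun s t hs ht => ?_) t
    · rw [hS, ← htmul, hS', map_smul, map_smul, smul_eq_mul, smul_eq_mul, mul_comm]
    · simp only [map_add, hs, ht]
  -- With s = Δ(a)(e ⊗ 1), g(L(a)) is close to g(S(s)), and f(R(a)) is close to f(R(a)e) = f(S'(s))
  -- = g(S(s)). Only f is required to be positive.
  have key : ∀ δ > 0, ‖g (L a) - f (R a)‖ ≤ δ * (‖g‖ * ‖a‖ + ‖R a‖) := by
    intro δ hδ
    obtain ⟨e, he⟩ := hf.exists_isAlmostUnit hδ
    obtain ⟨s, hs, hR⟩ := h' a e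
    rw [hinr] at hs
    have h1 := h.norm_sub_le hS hf hδ.le he hs
    have h2 := he.norm_sub_le hf hδ.le (R a)
    rw [hR, ← hSS] at h2
    have h3 : g (L a) - f (R a) = g (L a - S s) - (f (R a) - g (S s)) := by
      rw [map_sub]; ring
    rw [h3]
    refine (_root_.norm_sub_le _ _).trans ?_
    have h4 := g.le_opNorm_of_le h1
    linarith
  have h5 : ‖g (L a) - f (R a)‖ ≤ 0 := by
    have hc : Tendsto (fun δ : ℝ => δ * (‖g‖ * ‖a‖ + ‖R a‖)) (𝓝[>] 0) (𝓝 0) := by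
      have : Continuous fun δ : ℝ => δ * (‖g‖ * ‖a‖ + ‖R a‖) := by fun_prop
      simpa using (this.tendsto 0).mono_left nhdsWithin_le_nhds
    exact ge_of_tendsto hc (by filter_upwards [self_mem_nhdsWithin] with δ hδ using key δ hδ)
  exact sub_eq_zero.1 (norm_le_zero_iff.1 h5)

/-- A bounded counit is a character. -/
theorem IsConvolution.exists_character [Nontrivial A] {ε : A →L[ℂ] ℂ} {S : T →L[ℂ] A}
    (h : X.IsConvolution Δ S (ContinuousLinearMap.id ℂ A)) (hS : X.IsSlice ε S)
    (hd : Dense (Submodule.span ℂ {t : T | ∃ a d, (t : 𝓜(ℂ, T)) = Δ a * X.inr d} : Set T)) :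
    IsPositiveFunctional ε ∧ ∃ ε' : A →⋆ₙₐ[ℂ] ℂ, ∀ a, ε' a = ε a := by
  -- On x = Δ(a)(1 ⊗ d) and y = Δ(a')(1 ⊗ d') both sides are d*a*a'd', since the convolution is the
  -- identity. Density extends this to all of T.
  have h1 : ∀ x y, S (star x * y) = star (S x) * S y := by
    intro x
    refine hd.induction (P := fun x => ∀ y, S (star x * y) = star (S x) * S y) (fun x hx => ?_)
      ?_ x
    swap
    · simp only [Set.ofPred_forall]
      exact isClosed_iInter fun y => isClosed_eq (by fun_prop) (by fun_prop)
    refine Submodule.span_induction (p := fun x _ => ∀ y, S (star x * y) = star (S x) * S y)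
      ?_ ?_ ?_ ?_ hx
    · rintro x ⟨a, d, hx⟩ y
      have : S ∘L ContinuousLinearMap.mul ℂ T (star x) =
          ContinuousLinearMap.mul ℂ A (star (S x)) ∘L S := by
        refine ContinuousLinearMap.ext_on hd ?_
        rintro y ⟨a', d', hy⟩
        have h2 := h.star_mul_apply_mul hS hx hy
        simp only [ContinuousLinearMap.comp_apply, ContinuousLinearMap.mul_apply',
          ← h.apply_mul hx, ← h.apply_mul hy, ← h2, ContinuousLinearMap.id_apply, star_mul,
          mul_assoc]
      exact congrArg (fun F : T →L[ℂ] A => F y) this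
    · simp
    · intro x x' _ _ hx hx' y
      simp only [star_add, add_mul, map_add, hx, hx']
    · intro c x _ hx y
      simp only [star_smul, smul_mul_assoc, map_smul, hx]
  obtain ⟨b, hb⟩ := exists_ne (0 : A)
  -- On a ⊗ b and a' ⊗ b the multiplicativity of S compares two multiples of b*b, which is nonzero.
  have h2 : ∀ a a', ε (star a * a') = star (ε a) * ε a' := by
    intro a a'
    have h3 := h1 (X.tmul a b) (X.tmul a' b)
    rw [X.star_tmul, X.mul_tmul, hS, hS, hS, star_smul, smul_mul_smul_comm] at h3
    refine smul_left_injective ℂ ?_ h3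
    rwa [ne_eq, CStarRing.star_mul_self_eq_zero_iff]
  have hpos : IsPositiveFunctional ε := by
    intro a ha
    obtain ⟨x, rfl⟩ := CStarAlgebra.nonneg_iff_eq_star_mul_self.1 ha
    rw [h2]
    exact star_mul_self_nonneg _
  refine ⟨hpos, ⟨⟨⟨⟨ε, fun c a => map_smul ε c a⟩, map_zero ε, map_add ε⟩, fun a b => ?_⟩,
    hpos.map_star⟩, fun a => rfl⟩
  have h3 := h2 (star a) b
  rwa [star_star, hpos.map_star, star_star] at h3

end TensorModel

/-! ### The spatial tensor product as a model -/

namespace MinTensor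

variable {A B : Type*}
  [NonUnitalCStarAlgebra A] [PartialOrder A] [StarOrderedRing A]
  [NonUnitalCStarAlgebra B] [PartialOrder B] [StarOrderedRing B]

theorem norm_blockTensor_le (p : (A →ₚ[ℂ] ℂ) × (B →ₚ[ℂ] ℂ)) (S : p.1.GNS →L[ℂ] p.1.GNS)
    (T : p.2.GNS →L[ℂ] p.2.GNS) : ‖blockTensor p S T‖ ≤ ‖S‖ * ‖T‖ :=
  norm_opTensor_le S T

theorem norm_tmul_le (a : A) (b : B) : ‖tmul a b‖ ≤ ‖a‖ * ‖b‖ := by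
  have h : ‖(blockTmul a b : lp (fun p : (A →ₚ[ℂ] ℂ) × (B →ₚ[ℂ] ℂ) => BlockOp p) ∞)‖ ≤
      ‖a‖ * ‖b‖ := by
    refine lp.norm_le_of_forall_le (by positivity) fun p => ?_
    have h1 := block_blockTmul a b p
    refine (congrArg norm h1).le.trans ((norm_blockTensor_le p _ _).trans ?_)
    exact mul_le_mul (NonUnitalStarAlgHom.norm_apply_le _ a) (NonUnitalStarAlgHom.norm_apply_le _ b)
      (norm_nonneg _) (norm_nonneg _)
  exact h

theorem denseRange_ofTensor : DenseRange (ofTensor : A ⊗[ℂ] B → A ⊗ₛ B) := by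
  intro x
  have hx : (val x) ∈ closure (algTensor A B : Set (UniversalBlocks A B)) := x.2
  have hind : Topology.IsInducing (val : A ⊗ₛ B → UniversalBlocks A B) :=
    Topology.IsInducing.subtypeVal
      (t := ((algTensor A B).topologicalClosure : Set (UniversalBlocks A B)))
  rw [hind.closure_eq_preimage_closure_image]
  refine closure_mono ?_ hx
  intro y hy
  refine Submodule.span_induction (p := fun y _ => ∃ w ∈ Set.range (ofTensor : A ⊗[ℂ] B → A ⊗ₛ B),
    val w = y) ?_ ?_ ?_ ?_ hy
  · rintro _ ⟨p, rfl⟩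
    exact ⟨_, ⟨p.1 ⊗ₜ[ℂ] p.2, rfl⟩, rfl⟩
  · exact ⟨0, ⟨0, map_zero _⟩, map_zero _⟩
  · rintro _ _ _ _ ⟨_, ⟨z, rfl⟩, rfl⟩ ⟨_, ⟨w, rfl⟩, rfl⟩
    exact ⟨_, ⟨z + w, map_add _ _ _⟩, map_add _ _ _⟩
  · rintro c _ _ ⟨_, ⟨z, rfl⟩, rfl⟩
    exact ⟨_, ⟨c • z, map_smul _ _ _⟩, map_smul _ _ _⟩

theorem norm_block_val_le (p : (A →ₚ[ℂ] ℂ) × (B →ₚ[ℂ] ℂ)) (x : A ⊗ₛ B) :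
    ‖UniversalBlocks.block p (val x)‖ ≤ ‖x‖ :=
  (NonUnitalStarAlgHom.norm_apply_le (UniversalBlocks.block p) (val x)).trans
    (NonUnitalStarAlgHom.norm_apply_le val x)

end MinTensor

/-! ### Boundedness of slice maps for the spatial norm -/

section Functionals

variable {A B : Type*} [AddCommGroup A] [Module ℂ A] [AddCommGroup B] [Module ℂ B]

theorem TensorProduct.tendsto_lid_map {ι : Type*} {l : Filter ι} {φ : ι → A →ₗ[ℂ] ℂ}
    {ψ : ι → B →ₗ[ℂ] ℂ} {φ₀ : A →ₗ[ℂ] ℂ} {ψ₀ : B →ₗ[ℂ] ℂ}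
    (hφ : ∀ a, Tendsto (fun i => φ i a) l (𝓝 (φ₀ a)))
    (hψ : ∀ b, Tendsto (fun i => ψ i b) l (𝓝 (ψ₀ b))) (z : A ⊗[ℂ] B) :
    Tendsto (fun i => TensorProduct.lid ℂ ℂ (TensorProduct.map (φ i) (ψ i) z)) l
      (𝓝 (TensorProduct.lid ℂ ℂ (TensorProduct.map φ₀ ψ₀ z))) := by
  induction z using TensorProduct.induction_on with
  | zero => simpa using tendsto_const_nhds
  | tmul a b => simpa using (hφ a).mul (hψ b)
  | add z w hz hw => simpa only [map_add] using hz.add hw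

end Functionals

section Sandwich

variable {A : Type*} [NonUnitalCStarAlgebra A]

/-- The functional `x ↦ f(c* x e)`. -/
def sandwich (f : A →L[ℂ] ℂ) (c e : A) : A →ₗ[ℂ] ℂ :=
  f.toLinearMap ∘ₗ LinearMap.mulLeft ℂ (star c) ∘ₗ LinearMap.mulRight ℂ e

theorem sandwich_apply (f : A →L[ℂ] ℂ) (c e x : A) : sandwich f c e x = f (star c * (x * e)) := rfl

end Sandwich

namespace MinTensor

variable {A B : Type*}
  [NonUnitalCStarAlgebra A] [PartialOrder A] [StarOrderedRing A]
  [NonUnitalCStarAlgebra B] [PartialOrder B] [StarOrderedRing B]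

theorem _root_.IsPositiveFunctional.norm_toPreGNS_le {f : A →L[ℂ] ℂ} (hf : IsPositiveFunctional f)
    (a : A) : ‖hf.toPositiveLinearMap.toPreGNS a‖ ≤ √‖f‖ * ‖a‖ := by
  refine (sq_le_sq₀ (norm_nonneg _) (by positivity)).1 ?_
  have h := congrArg Complex.re
    (hf.toPositiveLinearMap.preGNS_norm_sq (hf.toPositiveLinearMap.toPreGNS a))
  rw [← Complex.ofReal_pow, Complex.ofReal_re] at h
  rw [h, mul_pow, Real.sq_sqrt (norm_nonneg f)]
  exact IsPositiveFunctional.re_apply_le f (a := star a * a)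
    (by rw [CStarRing.norm_star_mul_self, pow_two])

/-- The block at `p` of an element of the tensor product, as an operator. -/
def blockOp (p : (A →ₚ[ℂ] ℂ) × (B →ₚ[ℂ] ℂ)) (x : A ⊗ₛ B) :
    Completion (p.1.GNS ⊗[ℂ] p.2.GNS) →L[ℂ] Completion (p.1.GNS ⊗[ℂ] p.2.GNS) :=
  UniversalBlocks.block p (val x)

theorem blockOp_zero (p : (A →ₚ[ℂ] ℂ) × (B →ₚ[ℂ] ℂ)) : blockOp p (0 : A ⊗ₛ B) = 0 := by
  rw [blockOp, map_zero, map_zero]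
  rfl

theorem blockOp_add (p : (A →ₚ[ℂ] ℂ) × (B →ₚ[ℂ] ℂ)) (x y : A ⊗ₛ B) :
    blockOp p (x + y) = blockOp p x + blockOp p y := by
  rw [blockOp, map_add, map_add]
  rfl

theorem blockOp_tmul (p : (A →ₚ[ℂ] ℂ) × (B →ₚ[ℂ] ℂ)) (a : A) (b : B) :
    blockOp p (tmul a b) =
      opTensor (p.1.gnsNonUnitalStarAlgHom a) (p.2.gnsNonUnitalStarAlgHom b) := by
  rw [blockOp, val_tmul, block_blockTmul]
  rfl

theorem norm_blockOp_le (p : (A →ₚ[ℂ] ℂ) × (B →ₚ[ℂ] ℂ)) (x : A ⊗ₛ B) : ‖blockOp p x‖ ≤ ‖x‖ :=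
  norm_block_val_le p x

/-- The vector `c ⊗ d` in the tensor product of two GNS spaces. -/
def gnsTmul (p : (A →ₚ[ℂ] ℂ) × (B →ₚ[ℂ] ℂ)) (c : A) (d : B) : p.1.GNS ⊗[ℂ] p.2.GNS :=
  (p.1.toPreGNS c : p.1.GNS) ⊗ₜ[ℂ] (p.2.toPreGNS d : p.2.GNS)

theorem norm_gnsTmul (p : (A →ₚ[ℂ] ℂ) × (B →ₚ[ℂ] ℂ)) (c : A) (d : B) :
    ‖gnsTmul p c d‖ = ‖p.1.toPreGNS c‖ * ‖p.2.toPreGNS d‖ := by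
  rw [gnsTmul, TensorProduct.norm_tmul]
  exact congrArg₂ _ (Completion.norm_coe _) (Completion.norm_coe _)

theorem _root_.PositiveLinearMap.inner_toPreGNS_gnsNonUnitalStarAlgHom (f : A →ₚ[ℂ] ℂ)
    (c a e : A) : ⟪(f.toPreGNS c : f.GNS), f.gnsNonUnitalStarAlgHom a (f.toPreGNS e : f.GNS)⟫_ℂ =
      f (star c * (a * e)) := by
  rw [PositiveLinearMap.gnsNonUnitalStarAlgHom_apply_coe, Completion.inner_coe,
    PositiveLinearMap.preGNS_inner_def]
  simp

theorem inner_blockOp_tmul (p : (A →ₚ[ℂ] ℂ) × (B →ₚ[ℂ] ℂ)) (c e a : A) (d e' b : B) :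
    ⟪(gnsTmul p c d : Completion (p.1.GNS ⊗[ℂ] p.2.GNS)),
      blockOp p (tmul a b) (gnsTmul p e e' : Completion (p.1.GNS ⊗[ℂ] p.2.GNS))⟫_ℂ =
      p.1 (star c * (a * e)) * p.2 (star d * (b * e')) := by
  rw [blockOp_tmul, opTensor_coe, Completion.inner_coe, gnsTmul, gnsTmul,
    TensorProduct.mapL_apply, TensorProduct.map_tmul, TensorProduct.inner_tmul]
  exact congrArg₂ _ (p.1.inner_toPreGNS_gnsNonUnitalStarAlgHom c a e)
    (p.2.inner_toPreGNS_gnsNonUnitalStarAlgHom d b e')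

theorem _root_.ContinuousLinearMap.inner_apply_of_eq_add {H : Type*} [NormedAddCommGroup H]
    [InnerProductSpace ℂ H] {R S S' : H →L[ℂ] H} (h : R = S + S') (u v : H) :
    ⟪u, R v⟫_ℂ = ⟪u, S v⟫_ℂ + ⟪u, S' v⟫_ℂ := by
  rw [h, add_apply, inner_add_right]

theorem inner_blockOp_ofTensor {f : A →L[ℂ] ℂ} (hf : IsPositiveFunctional f) {g : B →L[ℂ] ℂ}
    (hg : IsPositiveFunctional g) (c e : A) (d e' : B) (z : A ⊗[ℂ] B)
    {p : (A →ₚ[ℂ] ℂ) × (B →ₚ[ℂ] ℂ)} (hp : p = (hf.toPositiveLinearMap, hg.toPositiveLinearMap)) :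
    TensorProduct.lid ℂ ℂ (TensorProduct.map (sandwich f c e) (sandwich g d e') z) =
      ⟪(gnsTmul p c d : Completion (p.1.GNS ⊗[ℂ] p.2.GNS)),
        blockOp p (ofTensor z) (gnsTmul p e e' : Completion (p.1.GNS ⊗[ℂ] p.2.GNS))⟫_ℂ := by
  induction z using TensorProduct.induction_on with
  | zero => rw [map_zero, map_zero, map_zero, blockOp_zero, zero_apply, inner_zero_right]
  | add z w hz hw =>
    have h := (congrArg (blockOp p) (map_add ofTensor z w)).trans (blockOp_add p _ _)
    rw [map_add, map_add, hz, hw]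
    exact (ContinuousLinearMap.inner_apply_of_eq_add h _ _).symm
  | tmul a b =>
    rw [ofTensor_tmul, inner_blockOp_tmul, hp]
    rfl

/-- The functional f(c* · e) ⊗ g(d* · e') is a matrix coefficient of one block of the universal
representation, hence controlled by the spatial norm and the norms of the two GNS vectors. -/
theorem norm_lid_map_sandwich_le {f : A →L[ℂ] ℂ} (hf : IsPositiveFunctional f) {g : B →L[ℂ] ℂ}
    (hg : IsPositiveFunctional g) (c e : A) (d e' : B) (z : A ⊗[ℂ] B) :
    ‖TensorProduct.lid ℂ ℂ (TensorProduct.map (sandwich f c e) (sandwich g d e') z)‖ ≤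
      ‖f‖ * ‖g‖ * (‖c‖ * ‖e‖ * ‖d‖ * ‖e'‖) * ‖(ofTensor z : A ⊗ₛ B)‖ := by
  obtain ⟨p, hp⟩ : ∃ p, p = (hf.toPositiveLinearMap, hg.toPositiveLinearMap) := ⟨_, rfl⟩
  have h1 : ∀ a, ‖p.1.toPreGNS a‖ ≤ √‖f‖ * ‖a‖ := by
    rw [hp]
    exact hf.norm_toPreGNS_le
  have h2 : ∀ b, ‖p.2.toPreGNS b‖ ≤ √‖g‖ * ‖b‖ := by
    rw [hp]
    exact hg.norm_toPreGNS_le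
  rw [inner_blockOp_ofTensor hf hg c e d e' z hp]
  refine (norm_inner_le_norm _ _).trans ?_
  refine (mul_le_mul_of_nonneg_left (ContinuousLinearMap.le_of_opNorm_le _
    (norm_blockOp_le p (ofTensor z)) _) (norm_nonneg _)).trans ?_
  rw [Completion.norm_coe, Completion.norm_coe, norm_gnsTmul, norm_gnsTmul]
  calc _ ≤ (√‖f‖ * ‖c‖) * (√‖g‖ * ‖d‖) *
        (‖(ofTensor z : A ⊗ₛ B)‖ * ((√‖f‖ * ‖e‖) * (√‖g‖ * ‖e'‖))) := by
        have h3 := mul_le_mul (h1 c) (h2 d) (norm_nonneg _) (by positivity)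
        have h4 := mul_le_mul (h1 e) (h2 e') (norm_nonneg _) (by positivity)
        exact mul_le_mul h3 (mul_le_mul_of_nonneg_left h4 (norm_nonneg _)) (by positivity)
          (by positivity)
    _ = (√‖f‖ * √‖f‖) * (√‖g‖ * √‖g‖) * (‖c‖ * ‖e‖ * ‖d‖ * ‖e'‖) * ‖(ofTensor z : A ⊗ₛ B)‖ := by
        ring
    _ = _ := by rw [Real.mul_self_sqrt (norm_nonneg f), Real.mul_self_sqrt (norm_nonneg g)]

theorem tendsto_sandwich_self (f : A →L[ℂ] ℂ) (a : A) :
    Tendsto (fun e => sandwich f e e a) (CStarAlgebra.approximateUnit A) (𝓝 (f a)) := by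
  refine ((f.continuous.tendsto a).comp
    (CStarAlgebra.tendsto_mul_mul_approximateUnit a)).congr' ?_
  filter_upwards [(CStarAlgebra.increasingApproximateUnit A).eventually_star_eq] with e he
  rw [sandwich_apply, he, ← mul_assoc]
  rfl

theorem tendsto_sandwich_right (f : A →L[ℂ] ℂ) (c a : A) :
    Tendsto (fun e => sandwich f c e a) (CStarAlgebra.approximateUnit A) (𝓝 (f (star c * a))) := by
  have h : Continuous fun x => f (star c * x) := by fun_prop
  exact (h.tendsto a).comp ((CStarAlgebra.increasingApproximateUnit A).tendsto_mul_left a)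

theorem eventually_norm_prod_le :
    ∀ᶠ q in CStarAlgebra.approximateUnit A ×ˢ CStarAlgebra.approximateUnit B,
      ‖q.1‖ ≤ 1 ∧ ‖q.2‖ ≤ 1 :=
  ((CStarAlgebra.increasingApproximateUnit A).eventually_norm).prod_mk
    ((CStarAlgebra.increasingApproximateUnit B).eventually_norm)

/-- Let y be the slice and g a positive contractive functional with g(y*y) = ‖y‖². Then ‖y‖² = (f ⊗
g(y* ·))(z), a limit of matrix coefficients along approximate units, each at most ‖f‖‖y‖‖z‖ with the
spatial norm of z. Dividing by ‖y‖ gives the bound. -/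
theorem norm_slice_left_le {f : A →L[ℂ] ℂ} (hf : IsPositiveFunctional f) (z : A ⊗[ℂ] B) :
    ‖TensorProduct.lid ℂ B (TensorProduct.map f.toLinearMap LinearMap.id z)‖ ≤
      ‖f‖ * ‖(ofTensor z : A ⊗ₛ B)‖ := by
  set y := TensorProduct.lid ℂ B (TensorProduct.map f.toLinearMap LinearMap.id z)
  obtain ⟨g, hg, hg1, hgy⟩ := exists_isPositiveFunctional_apply_star_mul_self y
  have h1 : TensorProduct.lid ℂ ℂ (TensorProduct.map f.toLinearMap
      (g.toLinearMap ∘ₗ LinearMap.mulLeft ℂ (star y)) z) = g (star y * y) := by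
    have h (y' : B) (z : A ⊗[ℂ] B) : TensorProduct.lid ℂ ℂ (TensorProduct.map f.toLinearMap
        (g.toLinearMap ∘ₗ LinearMap.mulLeft ℂ y') z) =
        g (y' * TensorProduct.lid ℂ B (TensorProduct.map f.toLinearMap LinearMap.id z)) := by
      induction z using TensorProduct.induction_on with
      | zero => simp
      | tmul a b => simp [mul_smul_comm]
      | add z w hz hw => simp only [map_add, mul_add, hz, hw]
    exact h _ z
  have h2 := TensorProduct.tendsto_lid_map
    (l := CStarAlgebra.approximateUnit A ×ˢ CStarAlgebra.approximateUnit B)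
    (φ := fun q => sandwich f q.1 q.1) (ψ := fun q => sandwich g y q.2) (φ₀ := f.toLinearMap)
    (ψ₀ := g.toLinearMap ∘ₗ LinearMap.mulLeft ℂ (star y))
    (fun a => (tendsto_sandwich_self f a).comp tendsto_fst)
    (fun b => (tendsto_sandwich_right g y b).comp tendsto_snd) z
  rw [h1, hgy] at h2
  have h3 : ‖((‖y‖ : ℂ) ^ 2)‖ ≤ ‖f‖ * 1 * (1 * 1 * ‖y‖ * 1) * ‖(ofTensor z : A ⊗ₛ B)‖ := by
    refine le_of_tendsto h2.norm ?_
    filter_upwards [eventually_norm_prod_le] with q hq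
    refine (norm_lid_map_sandwich_le hf hg _ _ _ _ z).trans ?_
    gcongr
    exacts [hq.1, hq.1, hq.2]
  rcases (norm_nonneg y).eq_or_lt with h0 | h0
  · rw [← h0]; positivity
  · rw [norm_pow, Complex.norm_real, norm_norm] at h3
    nlinarith

theorem norm_slice_right_le {g : B →L[ℂ] ℂ} (hg : IsPositiveFunctional g) (z : A ⊗[ℂ] B) :
    ‖TensorProduct.rid ℂ A (TensorProduct.map LinearMap.id g.toLinearMap z)‖ ≤
      ‖g‖ * ‖(ofTensor z : A ⊗ₛ B)‖ := by
  set y := TensorProduct.rid ℂ A (TensorProduct.map LinearMap.id g.toLinearMap z)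
  obtain ⟨f, hf, hf1, hfy⟩ := exists_isPositiveFunctional_apply_star_mul_self y
  have h1 : TensorProduct.lid ℂ ℂ (TensorProduct.map
      (f.toLinearMap ∘ₗ LinearMap.mulLeft ℂ (star y)) g.toLinearMap z) = f (star y * y) := by
    have h (y' : A) (z : A ⊗[ℂ] B) : TensorProduct.lid ℂ ℂ (TensorProduct.map
        (f.toLinearMap ∘ₗ LinearMap.mulLeft ℂ y') g.toLinearMap z) =
        f (y' * TensorProduct.rid ℂ A (TensorProduct.map LinearMap.id g.toLinearMap z)) := by
      induction z using TensorProduct.induction_on with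
      | zero => simp
      | tmul a b => simp [mul_smul_comm, mul_comm]
      | add z w hz hw => simp only [map_add, mul_add, hz, hw]
    exact h _ z
  have h2 := TensorProduct.tendsto_lid_map
    (l := CStarAlgebra.approximateUnit A ×ˢ CStarAlgebra.approximateUnit B)
    (φ := fun q => sandwich f y q.1) (ψ := fun q => sandwich g q.2 q.2)
    (φ₀ := f.toLinearMap ∘ₗ LinearMap.mulLeft ℂ (star y)) (ψ₀ := g.toLinearMap)
    (fun a => (tendsto_sandwich_right f y a).comp tendsto_fst)
    (fun b => (tendsto_sandwich_self g b).comp tendsto_snd) z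
  rw [h1, hfy] at h2
  have h3 : ‖((‖y‖ : ℂ) ^ 2)‖ ≤ 1 * ‖g‖ * (‖y‖ * 1 * 1 * 1) * ‖(ofTensor z : A ⊗ₛ B)‖ := by
    refine le_of_tendsto h2.norm ?_
    filter_upwards [eventually_norm_prod_le] with q hq
    refine (norm_lid_map_sandwich_le hf hg _ _ _ _ z).trans ?_
    gcongr
    exacts [hq.1, hq.2, hq.2]
  rcases (norm_nonneg y).eq_or_lt with h0 | h0
  · rw [← h0]; positivity
  · rw [norm_pow, Complex.norm_real, norm_norm] at h3
    nlinarith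

variable (A B)

theorem lift_mk_compr₂_ofTensor :
    TensorProduct.lift ((TensorProduct.mk ℂ A B).compr₂ ofTensor) = (ofTensor : _ →ₗ[ℂ] A ⊗ₛ B) :=
  TensorProduct.ext' fun a b => by simp

theorem lift_mk_compr₂_ofTensor_flip (z : B ⊗[ℂ] A) :
    TensorProduct.lift ((TensorProduct.mk ℂ A B).compr₂ ofTensor).flip z =
      (ofTensor (TensorProduct.comm ℂ B A z) : A ⊗ₛ B) := by
  induction z using TensorProduct.induction_on with
  | zero => simp
  | tmul b a => simp
  | add z w hz hw => simp only [map_add, hz, hw]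

/-- The spatial tensor product, with slices on the left. -/
def model : TensorModel A B (A ⊗ₛ B) where
  tmul := (TensorProduct.mk ℂ A B).compr₂ ofTensor
  mul_tmul a a' b b' := tmul_mul_tmul a a' b b'
  star_tmul a b := star_tmul a b
  norm_tmul_le a b := norm_tmul_le a b
  denseRange := by
    rw [lift_mk_compr₂_ofTensor]
    exact denseRange_ofTensor
  inl := inl
  inr := inr
  inl_fst c a b := inl_fst_tmul c a b
  inr_fst a c b := inr_fst_tmul a c b
  slice_bound f hf z := by
    rw [lift_mk_compr₂_ofTensor]
    exact norm_slice_left_le hf z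

/-- The spatial tensor product, with slices on the right. -/
def flipModel : TensorModel B A (A ⊗ₛ B) where
  tmul := ((TensorProduct.mk ℂ A B).compr₂ ofTensor).flip
  mul_tmul b b' a a' := tmul_mul_tmul a a' b b'
  star_tmul b a := star_tmul a b
  norm_tmul_le b a := (norm_tmul_le a b).trans_eq (mul_comm _ _)
  denseRange := by
    have h := (denseRange_ofTensor (A := A) (B := B))
    refine h.mono ?_
    rintro _ ⟨z, rfl⟩
    exact ⟨TensorProduct.comm ℂ A B z, by
      rw [lift_mk_compr₂_ofTensor_flip]
      simp⟩
  inl := inr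
  inr := inl
  inl_fst c b a := inr_fst_tmul a c b
  inr_fst b c a := inl_fst_tmul c a b
  slice_bound f hf z := by
    rw [lift_mk_compr₂_ofTensor_flip]
    convert norm_slice_right_le (A := A) hf (TensorProduct.comm ℂ B A z) using 2
    induction z using TensorProduct.induction_on with
    | zero => simp
    | tmul b a => simp
    | add z w hz hw => simp only [map_add, hz, hw]

variable {A B}

theorem isSlice_sliceLeft_of_bound {f : A →L[ℂ] ℂ}
    (h : ∃ C, ∀ z : A ⊗[ℂ] B, ‖TensorProduct.lid ℂ B (TensorProduct.map f.toLinearMap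
      LinearMap.id z)‖ ≤ C * ‖(ofTensor z : A ⊗ₛ B)‖) : (model A B).IsSlice f (sliceLeft f) := by
  intro a b
  have := LinearMap.extendOfNorm_eq (f := (TensorProduct.lid ℂ B).toLinearMap ∘ₗ
    TensorProduct.map f.toLinearMap LinearMap.id) denseRange_ofTensor h (a ⊗ₜ[ℂ] b)
  simpa using! this

theorem isSlice_sliceRight_of_bound {f : B →L[ℂ] ℂ}
    (h : ∃ C, ∀ z : A ⊗[ℂ] B, ‖TensorProduct.rid ℂ A (TensorProduct.map LinearMap.id
      f.toLinearMap z)‖ ≤ C * ‖(ofTensor z : A ⊗ₛ B)‖) :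
    (flipModel A B).IsSlice f (sliceRight f) := by
  intro b a
  have := LinearMap.extendOfNorm_eq (f := (TensorProduct.rid ℂ A).toLinearMap ∘ₗ
    TensorProduct.map LinearMap.id f.toLinearMap) denseRange_ofTensor h (a ⊗ₜ[ℂ] b)
  simpa using! this

/-- Without a bound the extension defaults to 0. Hence a nonzero slice map is a genuine one even for
a functional not known to be positive. -/
theorem _root_.LinearMap.extendOfNorm_eq_zero {E F G : Type*} [NormedAddCommGroup F]
    [NormedSpace ℂ F] [CompleteSpace F] [AddCommGroup E] [Module ℂ E] [NormedAddCommGroup G]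
    [NormedSpace ℂ G] {f : E →ₗ[ℂ] F} {e : E →ₗ[ℂ] G} (hd : DenseRange e)
    (h : ¬ ∃ C, ∀ x, ‖f x‖ ≤ C * ‖e x‖) :
    f.extendOfNorm e = 0 := by
  have h1 : f.compLeftInverse e = 0 := by
    rw [LinearMap.compLeftInverse, dif_neg h]
  rw [LinearMap.extendOfNorm, h1]
  exact ContinuousLinearMap.extend_zero (by simpa using! hd)
    isUniformEmbedding_subtype_val.isUniformInducing

theorem isSlice_sliceLeft_of_ne_zero {f : A →L[ℂ] ℂ} (h : (sliceLeft f : A ⊗ₛ B →L[ℂ] B) ≠ 0) :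
    (model A B).IsSlice f (sliceLeft f) :=
  isSlice_sliceLeft_of_bound (by
    by_contra hc
    exact h (LinearMap.extendOfNorm_eq_zero denseRange_ofTensor hc))

theorem isSlice_sliceRight_of_ne_zero {f : B →L[ℂ] ℂ} (h : (sliceRight f : A ⊗ₛ B →L[ℂ] A) ≠ 0) :
    (flipModel A B).IsSlice f (sliceRight f) :=
  isSlice_sliceRight_of_bound (by
    by_contra hc
    exact h (LinearMap.extendOfNorm_eq_zero denseRange_ofTensor hc))

theorem isSlice_sliceLeft {f : A →L[ℂ] ℂ} (hf : IsPositiveFunctional f) :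
    (model A B).IsSlice f (sliceLeft f) :=
  isSlice_sliceLeft_of_bound ⟨_, norm_slice_left_le hf⟩

theorem isSlice_sliceRight {f : B →L[ℂ] ℂ} (hf : IsPositiveFunctional f) :
    (flipModel A B).IsSlice f (sliceRight f) :=
  isSlice_sliceRight_of_bound ⟨_, norm_slice_right_le hf⟩

end MinTensor

/-! ### Idempotent states -/

theorem IsConditionalExpectation.ne_zero {A : Type*} [NonUnitalCStarAlgebra A] {E : A →L[ℂ] A}
    (hE : IsConditionalExpectation E) : E ≠ 0 := by
  rintro rfl
  simpa using hE.1

section Idempotent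

variable {A T : Type*} [NonUnitalCStarAlgebra A] [PartialOrder A] [StarOrderedRing A]
  [NonUnitalCStarAlgebra T] {X X' : TensorModel A A T} {Δ : A →⋆ₙₐ[ℂ] 𝓜(ℂ, T)}
  {ω ε : A →L[ℂ] ℂ} {S S' : T →L[ℂ] A} {L : A →L[ℂ] A}

theorem TensorModel.IsConvolution.isConditionalExpectation (h : X.IsConvolution Δ S L)
    (hS : X.IsSlice ω S) (hω : IsState ω) (hωL : ∀ a, ω (L a) = ω a) (hid : ∀ a, L (L a) = L a)
    {φ : CStarWeight A} (hφ : φ.IsDenselyDefined) (hfaith : φ.IsFaithful)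
    (hinv : ∀ a, 0 ≤ a → φ a < ∞ → φ (L a) = ENNReal.ofReal ‖ω‖ * φ a) :
    IsConditionalExpectation L := by
  have hstar := h.map_star hS hω.1
  refine isConditionalExpectation_of_idempotent ((h.norm_le hS hω.1).trans_eq hω.2) ?_ hstar hid
    (map_star_mul_of_schwarz_of_weight hid (fun a => ?_) hφ hfaith fun a ha hfin => ?_)
  -- If L vanished, then ω = ω ∘ L would vanish too, against ‖ω‖ = 1.
  · rintro rfl
    have h0 : ω = 0 := ContinuousLinearMap.ext fun a => by simpa using (hωL a).symm
    simpa [h0] using hω.2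
  · simpa [hω.2] using h.schwarz hS hω.1 a
  · rw [hinv a ha hfin, hω.2, ENNReal.ofReal_one, one_mul]

/-- Convolving with ε on the other leg is the identity, so Fubini gives ω = ε ∘ L with ε a
character; the rest is the statement for a conditional expectation followed by a character. -/
theorem IsConditionalExpectation.isState_of_isConvolution (hL : IsConditionalExpectation L)
    (h : X.IsConvolution Δ S L) (hS : X.IsSlice ω S)
    (hε : X'.IsConvolution Δ S' (ContinuousLinearMap.id ℂ A)) (hS' : X'.IsSlice ε S')
    (hd : Dense (Submodule.span ℂ {t : T | ∃ a d, (t : 𝓜(ℂ, T)) = Δ a * X'.inr d} : Set T))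
    (htmul : ∀ a b, X.tmul b a = X'.tmul a b) (hinr : X.inr = X'.inl) :
    IsState ω ∧ ∀ a, ω (L a) = ω a := by
  have hL0 := hL.ne_zero
  have : Nontrivial A := by
    by_contra hA
    rw [not_nontrivial_iff_subsingleton] at hA
    exact hL0 (ContinuousLinearMap.ext fun a => Subsingleton.elim _ _)
  obtain ⟨hpos, ε', hε'⟩ := hε.exists_character hS' hd
  have hωε : ∀ a, ω a = ε' (L a) := fun a => by
    rw [hε']
    exact hε.apply_eq hS' hpos h hS htmul hinr a
  refine ⟨hL.isState ε' hωε ?_, fun a => by rw [hωε, hL.idempotent, hωε]⟩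
  rintro rfl
  have hS0 : S = 0 := X.clm_ext fun a b => by simp [hS a b]
  refine hL0 (ContinuousLinearMap.ext fun a => CStarAlgebra.eq_of_forall_mul_right fun d => ?_)
  obtain ⟨t, -, ht⟩ := h a d
  rw [ht, hS0]
  simp

end Idempotent

/-! ### The cancellation laws read inside the tensor product -/

namespace DoubleCentralizer

variable {T : Type*} [NonUnitalCStarAlgebra T] {s : Set 𝓜(ℂ, T)}

theorem exists_coe_eq_of_closure_span_eq_range
    (h : ((Submodule.span ℂ s).topologicalClosure : Set 𝓜(ℂ, T)) =
      Set.range (DoubleCentralizer.coe ℂ)) {m : 𝓜(ℂ, T)} (hm : m ∈ s) :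
    ∃ t : T, (t : 𝓜(ℂ, T)) = m := by
  have : m ∈ ((Submodule.span ℂ s).topologicalClosure : Set 𝓜(ℂ, T)) :=
    subset_closure (Submodule.subset_span hm)
  rwa [h] at this

/-- The closure in the hypothesis is taken among multipliers; since the embedding of T is isometric,
density pulls back to T. -/
theorem dense_span_of_closure_span_eq_range
    (h : ((Submodule.span ℂ s).topologicalClosure : Set 𝓜(ℂ, T)) =
      Set.range (DoubleCentralizer.coe ℂ)) :
    Dense (Submodule.span ℂ {t : T | (t : 𝓜(ℂ, T)) ∈ s} : Set T) := by
  intro x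
  have hx : (x : 𝓜(ℂ, T)) ∈ closure (Submodule.span ℂ s : Set 𝓜(ℂ, T)) := by
    change (x : 𝓜(ℂ, T)) ∈ ((Submodule.span ℂ s).topologicalClosure : Set 𝓜(ℂ, T))
    rw [h]
    exact ⟨x, rfl⟩
  rw [DoubleCentralizer.isometry_coe.isUniformInducing.isInducing.closure_eq_preimage_closure_image]
  refine closure_mono ?_ hx
  intro y hy
  refine Submodule.span_induction (p := fun y _ =>
    ∃ w ∈ Submodule.span ℂ {t : T | (t : 𝓜(ℂ, T)) ∈ s}, (w : 𝓜(ℂ, T)) = y) ?_ ?_ ?_ ?_ hy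
  · intro m hm
    obtain ⟨t, rfl⟩ := exists_coe_eq_of_closure_span_eq_range h hm
    exact ⟨t, Submodule.subset_span hm, rfl⟩
  · exact ⟨0, zero_mem _, by simpa using DoubleCentralizer.coe_smul (0 : ℂ) (0 : T)⟩
  · rintro _ _ _ _ ⟨v, hv, rfl⟩ ⟨w, hw, rfl⟩
    exact ⟨v + w, add_mem hv hw, DoubleCentralizer.coe_add v w⟩
  · rintro c _ _ ⟨w, hw, rfl⟩
    exact ⟨c • w, Submodule.smul_mem _ c hw, DoubleCentralizer.coe_smul c w⟩

end DoubleCentralizer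

theorem TensorModel.dense_span_of_closure_span_eq_range {A T : Type*} [NonUnitalCStarAlgebra A]
    [PartialOrder A] [NonUnitalCStarAlgebra T] {X : TensorModel A A T} {Δ : A →⋆ₙₐ[ℂ] 𝓜(ℂ, T)}
    (h : ((Submodule.span ℂ {m : 𝓜(ℂ, T) | ∃ a b, m = Δ a * X.inr b}).topologicalClosure :
      Set 𝓜(ℂ, T)) = Set.range (DoubleCentralizer.coe ℂ)) :
    Dense (Submodule.span ℂ {t : T | ∃ a d, (t : 𝓜(ℂ, T)) = Δ a * X.inr d} : Set T) := by
  simpa only [Set.mem_ofPred_eq] using DoubleCentralizer.dense_span_of_closure_span_eq_range h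

/-! ### Convolution operators that are not default values -/

section Convolution

open MinTensor

variable {A : Type*} [NonUnitalCStarAlgebra A] [PartialOrder A] [StarOrderedRing A]
  {Δ : A →⋆ₙₐ[ℂ] 𝓜(ℂ, A ⊗ₛ A)} {ω : A →L[ℂ] ℂ}

theorem isConvolution_leftConvolution_of_exists (h : ∃ L, IsLeftConvolution Δ ω L) :
    (model A A).IsConvolution Δ (sliceLeft ω) (leftConvolution Δ ω) := by
  rw [leftConvolution, dif_pos h]
  exact h.choose_spec

theorem isConvolution_leftConvolution_of_ne_zero (h : leftConvolution Δ ω ≠ 0) :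
    (model A A).IsConvolution Δ (sliceLeft ω) (leftConvolution Δ ω) :=
  isConvolution_leftConvolution_of_exists (by
    by_contra hex
    exact h (dif_neg hex))

/-- For merely bounded ω both the slice map and the convolution may be the default 0. Conditional
expectations are nonzero, so this suffices in the converse direction and no decomposition of ω into
positive functionals is needed. -/
theorem isSlice_sliceLeft_of_leftConvolution_ne_zero (h : leftConvolution Δ ω ≠ 0) :
    (model A A).IsSlice ω (sliceLeft ω) := by
  refine isSlice_sliceLeft_of_ne_zero fun h0 => h ?_
  refine ContinuousLinearMap.ext fun a => CStarAlgebra.eq_of_forall_mul_right fun d => ?_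
  obtain ⟨t, -, ht⟩ := isConvolution_leftConvolution_of_ne_zero h a d
  rw [ht, h0]
  simp

theorem IsPositiveFunctional.isConvolution_leftConvolution (hω : IsPositiveFunctional ω)
    (hΔ : (model A A).IsRegular Δ) :
    (model A A).IsConvolution Δ (sliceLeft ω) (leftConvolution Δ ω) :=
  isConvolution_leftConvolution_of_exists ((isSlice_sliceLeft hω).exists_isConvolution hω hΔ)

theorem isConvolution_rightConvolution_of_exists (h : ∃ R, IsRightConvolution Δ ω R) :
    (flipModel A A).IsConvolution Δ (sliceRight ω) (rightConvolution Δ ω) := by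
  rw [rightConvolution, dif_pos h]
  exact h.choose_spec

theorem isConvolution_rightConvolution_of_ne_zero (h : rightConvolution Δ ω ≠ 0) :
    (flipModel A A).IsConvolution Δ (sliceRight ω) (rightConvolution Δ ω) :=
  isConvolution_rightConvolution_of_exists (by
    by_contra hex
    exact h (dif_neg hex))

theorem isSlice_sliceRight_of_rightConvolution_ne_zero (h : rightConvolution Δ ω ≠ 0) :
    (flipModel A A).IsSlice ω (sliceRight ω) := by
  refine isSlice_sliceRight_of_ne_zero fun h0 => h ?_
  refine ContinuousLinearMap.ext fun a => CStarAlgebra.eq_of_forall_mul_right fun d => ?_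
  obtain ⟨t, -, ht⟩ := isConvolution_rightConvolution_of_ne_zero h a d
  rw [ht, h0]
  simp

theorem IsPositiveFunctional.isConvolution_rightConvolution (hω : IsPositiveFunctional ω)
    (hΔ : (flipModel A A).IsRegular Δ) :
    (flipModel A A).IsConvolution Δ (sliceRight ω) (rightConvolution Δ ω) :=
  isConvolution_rightConvolution_of_exists ((isSlice_sliceRight hω).exists_isConvolution hω hΔ)

end Convolution

/-! ### Left and right convolution operators of the quantum group -/

namespace LocallyCompactQuantumGroup

open MinTensor

variable {A : Type*} [NonUnitalCStarAlgebra A] [PartialOrder A] [StarOrderedRing A]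
  (G : LocallyCompactQuantumGroup A) {ω : A →L[ℂ] ℂ}

theorem isRegular : (model A A).IsRegular G.comul := fun a d =>
  ⟨DoubleCentralizer.exists_coe_eq_of_closure_span_eq_range G.cancellation_right ⟨a, d, rfl⟩,
    DoubleCentralizer.exists_coe_eq_of_closure_span_eq_range G.cancellation_left ⟨a, d, rfl⟩⟩

theorem isRegular_flip : (flipModel A A).IsRegular G.comul := fun a d => (G.isRegular a d).symm

/-- Both sides are (ω ⊗ μ)Δ(a). For μ = ω this makes the idempotency condition independent of the
side. -/
theorem apply_L_eq_apply_R {μ : A →L[ℂ] ℂ} (hω : IsPositiveFunctional ω)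
    (hμ : IsPositiveFunctional μ) (a : A) : μ (G.L ω a) = ω (G.R μ a) :=
  (hω.isConvolution_leftConvolution G.isRegular).apply_eq (isSlice_sliceLeft hω) hω
    (hμ.isConvolution_rightConvolution G.isRegular_flip) (isSlice_sliceRight hμ)
    (fun _ _ => rfl) rfl a

theorem L_comp_self (hω : IsPositiveFunctional ω) (h : ∀ a, ω (G.L ω a) = ω a) (a : A) :
    G.L ω (G.L ω a) = G.L ω a := by
  obtain ⟨α, Φ, Ψ, hα, hΦ, hΨ, hco⟩ := G.coassociative
  exact (hω.isConvolution_leftConvolution G.isRegular).comp_self (Y := model A (A ⊗ₛ A))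
    (Z := model (A ⊗ₛ A) A) (isSlice_sliceLeft hω) hω G.nondegenerate G.isRegular
    (α := (α : A ⊗ₛ A ⊗ₛ A →⋆ₙₐ[ℂ] A ⊗ₛ (A ⊗ₛ A))) hα hΦ hΨ hco h a

theorem R_comp_self (hω : IsPositiveFunctional ω) (h : ∀ a, ω (G.R ω a) = ω a) (a : A) :
    G.R ω (G.R ω a) = G.R ω a := by
  obtain ⟨α, Φ, Ψ, hα, hΦ, hΨ, hco⟩ := G.coassociative
  -- Exchanging the tensor legs swaps the roles of Δ ⊗ id and id ⊗ Δ and reverses the associator.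
  refine (hω.isConvolution_rightConvolution G.isRegular_flip).comp_self
    (Y := flipModel (A ⊗ₛ A) A) (Z := flipModel A (A ⊗ₛ A)) (isSlice_sliceRight hω) hω
    G.nondegenerate G.isRegular_flip (Φ := Ψ) (Ψ := Φ)
    (α := (α.symm : A ⊗ₛ (A ⊗ₛ A) →⋆ₙₐ[ℂ] A ⊗ₛ A ⊗ₛ A)) (fun a b c => ?_)
    (fun a b c d => hΨ b a d c) (fun a b c d => hΦ b a d c) (fun a x => ?_) h a
  · exact α.symm_apply_eq.2 (hα c b a).symm
  · refine α.symm_apply_eq.2 ?_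
    rw [hco]
    exact congrArg (Ψ (G.comul a)).fst (α.apply_symm_apply x).symm

theorem isConditionalExpectation_L (hω : IsState ω) (h : ∀ a, ω (G.L ω a) = ω a) :
    IsConditionalExpectation (G.L ω) := by
  obtain ⟨φ, hφ, hfaith, hinv⟩ := G.exists_leftHaar
  exact (hω.1.isConvolution_leftConvolution G.isRegular).isConditionalExpectation
    (isSlice_sliceLeft hω.1) hω h (G.L_comp_self hω.1 h) hφ.1 hfaith (hinv ω hω.1)

theorem isConditionalExpectation_R (hω : IsState ω) (h : ∀ a, ω (G.R ω a) = ω a) :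
    IsConditionalExpectation (G.R ω) := by
  obtain ⟨φ, hφ, hfaith, hinv⟩ := G.exists_rightHaar
  exact (hω.1.isConvolution_rightConvolution G.isRegular_flip).isConditionalExpectation
    (isSlice_sliceRight hω.1) hω h (G.R_comp_self hω.1 h) hφ.1 hfaith (hinv ω hω.1)

theorem isIdempotentState_iff :
    G.IsIdempotentState ω ↔ IsState ω ∧ ∀ a, ω (G.L ω a) = ω a :=
  and_congr_right fun _ => ContinuousLinearMap.ext_iff

variable {G}

theorem isState_of_isConditionalExpectation_L (hG : G.IsCoamenable)
    (hL : IsConditionalExpectation (G.L ω)) : IsState ω ∧ ∀ a, ω (G.L ω a) = ω a := by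
  obtain ⟨ε, -, hR⟩ := hG
  have hL0 := hL.ne_zero
  have hid : rightConvolution G.comul ε = ContinuousLinearMap.id ℂ A :=
    ContinuousLinearMap.ext hR
  -- If R_ε were zero, then the identity of A would be zero, and with it L_ω.
  have hR0 : rightConvolution G.comul ε ≠ 0 := fun h0 =>
    hL0 (ContinuousLinearMap.ext fun a => by rw [← hR (G.L ω a), R, h0]; rfl)
  have hε := isConvolution_rightConvolution_of_ne_zero hR0
  rw [hid] at hε
  exact hL.isState_of_isConvolution (isConvolution_leftConvolution_of_ne_zero hL0)
    (isSlice_sliceLeft_of_leftConvolution_ne_zero hL0) hε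
    (isSlice_sliceRight_of_rightConvolution_ne_zero hR0)
    (TensorModel.dense_span_of_closure_span_eq_range G.cancellation_left)
    (fun _ _ => rfl) rfl

theorem isState_of_isConditionalExpectation_R (hG : G.IsCoamenable)
    (hR : IsConditionalExpectation (G.R ω)) : IsState ω ∧ ∀ a, ω (G.R ω a) = ω a := by
  obtain ⟨ε, hL, -⟩ := hG
  have hR0 := hR.ne_zero
  have hid : leftConvolution G.comul ε = ContinuousLinearMap.id ℂ A :=
    ContinuousLinearMap.ext hL
  have hL0 : leftConvolution G.comul ε ≠ 0 := fun h0 =>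
    hR0 (ContinuousLinearMap.ext fun a => by rw [← hL (G.R ω a), L, h0]; rfl)
  have hε := isConvolution_leftConvolution_of_ne_zero hL0
  rw [hid] at hε
  exact hR.isState_of_isConvolution (isConvolution_rightConvolution_of_ne_zero hR0)
    (isSlice_sliceRight_of_rightConvolution_ne_zero hR0) hε
    (isSlice_sliceLeft_of_leftConvolution_ne_zero hL0)
    (TensorModel.dense_span_of_closure_span_eq_range G.cancellation_right)
    (fun _ _ => rfl) rfl

end LocallyCompactQuantumGroup

end

theorem mainTheorem5 {A : Type*} [NonUnitalCStarAlgebra A] [PartialOrder A] [StarOrderedRing A]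
    (G : LocallyCompactQuantumGroup A) (hG : G.IsCoamenable) (ω : A →L[ℂ] ℂ) :
    (G.IsIdempotentState ω ↔ IsConditionalExpectation (G.L ω)) ∧
      (G.IsIdempotentState ω ↔ IsConditionalExpectation (G.R ω)) := by
  simp only [G.isIdempotentState_iff]
  refine ⟨⟨fun h => G.isConditionalExpectation_L h.1 h.2,
    LocallyCompactQuantumGroup.isState_of_isConditionalExpectation_L hG⟩, fun h =>
    G.isConditionalExpectation_R h.1 fun a => ?_, fun hR => ?_⟩
  · rw [← G.apply_L_eq_apply_R h.1.1 h.1.1, h.2]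
  · obtain ⟨hω, h⟩ := LocallyCompactQuantumGroup.isState_of_isConditionalExpectation_R hG hR
    exact ⟨hω, fun a => by rw [G.apply_L_eq_apply_R hω.1 hω.1, h]⟩
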